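/- **Seven catenoids.** All surfaces below are rotationally symmetric about the $x_3$-axis in $\mathbb R^3$, their profile curves lie in the $x_1x_3$-plane and are normalized to have neck radius $1$ at height $0$; a discrete profile curve is a sequence of vertices $(x(n),0,n\ell)^t$, $n\in\mathbb Z$, with constant vertical spacing, $x(n)>0$, and with a neck vertex: $x(0)=1$ and $x(-n)=x(n)$. A semi-discrete surface is a map $x:\mathbb Z\times\mathbb R\to\mathbb R^3$, $(k,t)\mapsto x(k,t)$, differentiable in $t$, with $\partial x=\partial x/\partial t$, $x_1=x(k+1,t)$, $\Delta x=x_1-x$. It is conjugate if $\partial x,\Delta x,\partial\Delta x$ are linearly dependent; circular if for all $k,t$ there is a circle through $x$ and $x_1$ tangent there to $\partial x$ and $\partial x_1$; isothermic if it is circular and there are positive functions $\nu(k,t)$, $\sigma(k)$, $\tau(t)$ with $\|\Delta x\|^2=\sigma\nu\nu_1$ and $\|\partial x\|^2=\tau\nu^2$; and minimal if it is isothermic and, for such a $\nu$, it has a dual $x^*$ (both surfaces conjugate, $\partial x^*=-\nu^{-2}\partial x$, $\Delta x^*=(\nu\nu_1)^{-1}\Delta x$) that is inscribed in a sphere. *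 *Smooth catenoid:* $(\cosh u\cos v,\cosh u\sin v,u)^t$, with profile curve $v=0$. * *$MW^{in}_{pd,rs}$* (spacing $h>0$): semi-discrete minimal surface $(f(k)\cos t,f(k)\sin t,hk)^t$, $f>0$, with a neck vertex and $f(0)=1$. * *$MW^{in}_{ps,rd}$* (angle $\alpha>0$, $\alpha\notin2\pi\mathbb Z$): semi-discrete minimal surface $(f(t)\cos\alpha k,f(t)\sin\alpha k,t)^t$, $f>0$, $f(0)=1$, $f'(0)=0$. * *$BP^{in}_{pd,rd}$* ($c_1\neq0$, $c_2\notin2\pi\mathbb Z$): the net $x:\mathbb Z^2\to\mathbb R^3$ with $x(0,0)=(1,0,0)^t$ and, for every edge $p=(n,m)$, $q=(n+1,m)$ or $q=(n,m+1)$, $$x(q)-x(p)=\mathrm{Re}\Big(\tfrac{a_{pq}}{g_q-g_p}(1-g_qg_p,\ i+ig_qg_p,\ g_q+g_p)^t\Big),$$ where $g_{n,m}=-e^{c_1n+ic_2m}$ and $a_{pq}=2\sinh^2\frac{c_1}2$, resp. $a_{pq}=-2\sin^2\frac{c_2}2$, on the two kinds of edges (their quotient is the cross ratio of $g$ on each elementary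 quadrilateral); its profile curve is $n\mapsto x(n,0)$. * *$PR^{va}_{pd,rd}$* (dihedral angle $\theta=2\pi/K$, $K\ge3$ an integer; spacing $\ell>0$): the mesh with vertices $(x(n)\cos m\theta,x(n)\sin m\theta,n\ell)^t$, $n\in\mathbb Z$, $m\in\mathbb Z/K$, each of whose quadrilaterals is divided into two triangles by an arbitrarily chosen diagonal, and which is critical for area with respect to all compactly supported smooth variations of its vertices. * *$M^{va}_{pd,rs}$* (spacing $\ell>0$): the surface of revolution, composed of truncated cones, whose profile is the polygon with vertices $(x(n),0,n\ell)^t$, and which is critical for area with respect to all compactly supported smooth rotationally invariant variations (that is, variations of the profile vertices in the $x_1x_3$-plane). * *$M^{va}_{ps,rd}$* (angle $2\pi/K$, $K\ge3$ an integer): the surface made of $K$ congruent pieces, each formed by the horizontal segments joining $(x(t),0,t)^t$ to its image under rotation by $2\pi/K$, $t\in\mathbb R$, with $x>0$ smooth, $x(0)=1$, $x'(0)=0$, and such that for every $r>0$ the part with $|t|\le r$ is critical for area with respect to smooth variations of the function $x$ that fix $x(\pm r)$. **Theorem.** For each admissible choice of the parameters (and of the diagonals, for $PR$) the normalized catenoid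 of each type has exactly one profile curve. Here profile curves are "the same" or "not the same" as point sets in $\mathbb R^3$. Moreover: 1. A $PR^{va}_{pd,rd}$ profile curve and an $M^{va}_{pd,rs}$ profile curve are never the same (for any parameters), but, for each fixed $\ell>0$, the $PR^{va}_{pd,rd}$ profile curves with angle $2\pi/K$ and spacing $\ell$ converge vertex by vertex to the $M^{va}_{pd,rs}$ profile curve with spacing $\ell$ as $K\to\infty$. 2. For every $c_2\notin2\pi\mathbb Z$, the $BP^{in}_{pd,rd}$-catenoids ($c_1\ne0$) and the $MW^{in}_{pd,rs}$-catenoids ($h>0$) have the same profile curves: a point set is a profile curve of one of the former if and only if it is a profile curve of one of the latter. 3. $BP^{in}_{pd,rd}$ (and likewise $MW^{in}_{pd,rs}$) profile curves and $PR^{va}_{pd,rd}$ profile curves are never the same, and $BP^{in}_{pd,rd}$ (and likewise $MW^{in}_{pd,rs}$) profile curves and $M^{va}_{pd,rs}$ profile curves are never the same. 4. The $MW^{in}_{ps,rd}$ profile curve, for every $\alpha$, is that of the smooth catenoid, $t\mapsto(\cosh t,0,t)^t$. 5. An $M^{va}_{ps,rd}$ profile curve is never the same as that of the smooth catenoid,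 but the $M^{va}_{ps,rd}$ profile curves with angle $2\pi/K$ converge, locally uniformly in $t$, to that of the smooth catenoid (equivalently, of the $MW^{in}_{ps,rd}$-catenoid) as $K\to\infty$. 6. For all seven types, all vertices (points) of each profile curve lie on one affinely scaled graph of the hyperbolic cosine, $\{(a\cosh s,0,bs)^t: s\in\mathbb R\}$ with some $a,b>0$. -/

import Mathlib

open Filter Topology
open scoped ContDiff

noncomputable section

namespace Catenoids

/-- Euclidean three-space. -/
abbrev E3 := EuclideanSpace ℝ (Fin 3)

/-- The rotation about the `x₃`-axis by the angle `φ`, applied to the point `(r, 0, z)` of the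
`x₁x₃`-plane. -/
def rotPt (r φ z : ℝ) : E3 := !₂[r * Real.cos φ, r * Real.sin φ, z]

/-- The profile curve in the `x₁x₃`-plane with radii `x n` at the heights `n * ℓ`
(a sequence of vertices). -/
def discreteProfile (ℓ : ℝ) (x : ℤ → ℝ) : ℤ → E3 := fun n => !₂[x n, 0, (n : ℝ) * ℓ]

/-- The profile curve in the `x₁x₃`-plane with radius `x t` at the height `t`. -/
def graphProfile (x : ℝ → ℝ) : ℝ → E3 := fun t => !₂[x t, 0, t]

/-! ### Areas -/

/-- Area of the parallelogram spanned by two vectors. -/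
def parallelogramArea (v w : E3) : ℝ := √(‖v‖ ^ 2 * ‖w‖ ^ 2 - (inner ℝ v w) ^ 2)

/-- Area of the triangle with vertices `p`, `q`, `r`. -/
def triangleArea (p q r : E3) : ℝ := parallelogramArea (q - p) (r - p) / 2

/-- Area of the parametrized surface patch `X : [a, b] × [c, d] → ℝ³`. -/
def patchArea (X : ℝ → ℝ → E3) (a b c d : ℝ) : ℝ :=
  ∫ u in a..b, ∫ t in c..d,
    parallelogramArea (deriv (fun u' => X u' t) u) (deriv (fun t' => X u t') t)

/-! ### The smooth catenoid -/

/-- The smooth catenoid, with neck radius `1`. -/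
def smoothCatenoid (u v : ℝ) : E3 := rotPt (Real.cosh u) v u

/-- Its profile curve `v = 0`. -/
def smoothProfile : ℝ → E3 := fun u => smoothCatenoid u 0

/-! ### Semi-discrete minimal surfaces (integrable systems approach)

A semi-discrete surface is a map `x : ℤ → ℝ → E3`, differentiable in the second variable. -/

/-- The derivative `∂x` in the smooth variable. -/
def sdDeriv (x : ℤ → ℝ → E3) (k : ℤ) (t : ℝ) : E3 := deriv (x k) t

/-- The difference `Δx = x₁ - x` in the discrete variable. -/
def sdDiff (x : ℤ → ℝ → E3) (k : ℤ) (t : ℝ) : E3 := x (k + 1) t - x k t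

/-- `x` is conjugate: `∂x`, `Δx`, `∂Δx` are linearly dependent. -/
def IsConjugate (x : ℤ → ℝ → E3) : Prop :=
  (∀ k, Differentiable ℝ (x k)) ∧
  ∀ k t, ¬ LinearIndependent ℝ ![sdDeriv x k t, sdDiff x k t, sdDeriv (sdDiff x) k t]

/-- `x` is circular: there is a circle (with centre `c` and radius `r`, in the plane `c + P`)
through `x` and `x₁` which is tangent there to `∂x` and `∂x₁`. -/
def IsCircular (x : ℤ → ℝ → E3) : Prop :=
  (∀ k, Differentiable ℝ (x k)) ∧
  ∀ k t, ∃ (c : E3) (r : ℝ) (P : Submodule ℝ E3), 0 < r ∧ Module.finrank ℝ P = 2 ∧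
    (x k t - c ∈ P ∧ ‖x k t - c‖ = r ∧
      sdDeriv x k t ∈ P ∧ inner ℝ (sdDeriv x k t) (x k t - c) = 0) ∧
    (x (k + 1) t - c ∈ P ∧ ‖x (k + 1) t - c‖ = r ∧
      sdDeriv x (k + 1) t ∈ P ∧ inner ℝ (sdDeriv x (k + 1) t) (x (k + 1) t - c) = 0)

/-- `x` is isothermic with the positive data `ν`, `σ`, `τ`; the conditions `∂σ = 0` and `Δτ = 0`
say that `σ` depends only on the discrete and `τ` only on the smooth variable. -/
def IsIsothermicWith (x : ℤ → ℝ → E3) (ν : ℤ → ℝ → ℝ) (σ : ℤ → ℝ) (τ : ℝ → ℝ) : Prop :=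
  IsCircular x ∧ (∀ k t, 0 < ν k t) ∧ (∀ k, 0 < σ k) ∧ (∀ t, 0 < τ t) ∧
  (∀ k t, ‖sdDiff x k t‖ ^ 2 = σ k * ν k t * ν (k + 1) t) ∧
  (∀ k t, ‖sdDeriv x k t‖ ^ 2 = τ t * ν k t ^ 2)

/-- `x` and `xs` are dual with respect to `ν`. -/
def IsDualWith (x xs : ℤ → ℝ → E3) (ν : ℤ → ℝ → ℝ) : Prop :=
  IsConjugate x ∧ IsConjugate xs ∧ (∀ k t, 0 < ν k t) ∧
  (∀ k t, sdDeriv xs k t = -(1 / ν k t ^ 2) • sdDeriv x k t) ∧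
  (∀ k t, sdDiff xs k t = (1 / (ν k t * ν (k + 1) t)) • sdDiff x k t)

/-- A semi-discrete isothermic surface is minimal if its dual is inscribed in a sphere. -/
def IsSemiDiscreteMinimal (x : ℤ → ℝ → E3) : Prop :=
  ∃ (ν : ℤ → ℝ → ℝ) (σ : ℤ → ℝ) (τ : ℝ → ℝ), IsIsothermicWith x ν σ τ ∧
    ∃ xs : ℤ → ℝ → E3, IsDualWith x xs ν ∧
      ∃ (c : E3) (R : ℝ), 0 < R ∧ ∀ k t, ‖xs k t - c‖ = R

/-- Profile curves of the Mueller-Wallner catenoids with discrete profile and smooth rotational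
direction, with vertical spacing `h`: the surface is semi-discrete minimal, there is a neck vertex
at index `0`, and the neck radius is `1`. -/
def MWpdrsProfiles (h : ℝ) : Set (ℤ → E3) :=
  {p | ∃ f : ℤ → ℝ, (∀ k, 0 < f k) ∧ f 0 = 1 ∧ (∀ k, f (-k) = f k) ∧
    IsSemiDiscreteMinimal (fun k t => rotPt (f k) t (h * k)) ∧ p = discreteProfile h f}

/-- Profile curves of the Mueller-Wallner catenoids with smooth profile and discrete rotational
direction, with rotation angle `α`, normalized at the neck. -/
def MWpsrdProfiles (α : ℝ) : Set (ℝ → E3) :=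
  {p | ∃ f : ℝ → ℝ, (∀ t, 0 < f t) ∧ f 0 = 1 ∧ deriv f 0 = 0 ∧
    IsSemiDiscreteMinimal (fun k t => rotPt (f t) (α * k) t) ∧ p = graphProfile f}

/-! ### Discrete minimal surfaces (integrable systems approach) -/

/-- The cross ratio of four complex numbers. -/
def crossRatio (a b c d : ℂ) : ℂ := (a - b) * (c - d) / ((b - c) * (d - a))

/-- The difference of the endpoints of an edge in the discrete Weierstrass representation. -/
def weierstrassEdge (a : ℝ) (gp gq : ℂ) : E3 :=
  !₂[((a : ℂ) / (gq - gp) * (1 - gq * gp)).re,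
     ((a : ℂ) / (gq - gp) * (Complex.I + Complex.I * gq * gp)).re,
     ((a : ℂ) / (gq - gp) * (gq + gp)).re]

/-- `X` is the discrete minimal surface with Weierstrass data `g`, where `a` (on the edges in the
first direction) and `b` (on those in the second) factorize the cross ratios of `g`. -/
def IsWeierstrassNet (g : ℤ → ℤ → ℂ) (a b : ℤ → ℝ) (X : ℤ → ℤ → E3) : Prop :=
  (∀ n m, crossRatio (g n m) (g (n + 1) m) (g (n + 1) (m + 1)) (g n (m + 1)) =
    (a n : ℂ) / (b m : ℂ)) ∧
  (∀ n m, X (n + 1) m - X n m = weierstrassEdge (a n) (g n m) (g (n + 1) m)) ∧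
  (∀ n m, X n (m + 1) - X n m = weierstrassEdge (b m) (g n m) (g n (m + 1)))

/-- Profile curves of the Bobenko-Pinkall catenoids: `g = c exp (c₁ n + i c₂ m)`, with edge
functions `-α sinh² (c₁/2)` and `α sin² (c₂/2)`, where `c = -1` and `α = -2`, and with the neck
vertex at `(1, 0, 0)`. -/
def BPProfiles (c₁ c₂ : ℝ) : Set (ℤ → E3) :=
  {p | ∃ X : ℤ → ℤ → E3,
    IsWeierstrassNet
      (fun n m => (-1 : ℂ) * Complex.exp ((c₁ : ℂ) * (n : ℂ) + Complex.I * (c₂ : ℂ) * (m : ℂ)))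
      (fun _ => -(-2) * Real.sinh (c₁ / 2) ^ 2) (fun _ => (-2) * Real.sin (c₂ / 2) ^ 2) X ∧
    X 0 0 = !₂[1, 0, 0] ∧ p = fun n => X n 0}

/-! ### Area-critical triangulated meshes -/

/-- The vertices of the rotationally symmetric mesh with `K` meridians. -/
def rotMesh (K : ℕ) (ℓ : ℝ) (x : ℤ → ℝ) (n m : ℤ) : E3 :=
  rotPt (x n) (2 * Real.pi * m / K) (n * ℓ)

/-- Area of the two triangles into which the quadrilateral with lower left corner `(n, m)` is
divided; `δ n m` says which of its two diagonals is used. -/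
def cellArea (δ : ℤ → ℤ → Bool) (V : ℤ → ℤ → E3) (n m : ℤ) : ℝ :=
  if δ n m then
    triangleArea (V n m) (V n (m + 1)) (V (n + 1) (m + 1)) +
      triangleArea (V n m) (V (n + 1) (m + 1)) (V (n + 1) m)
  else
    triangleArea (V n m) (V n (m + 1)) (V (n + 1) m) +
      triangleArea (V n (m + 1)) (V (n + 1) (m + 1)) (V (n + 1) m)

/-- Area of the part of the mesh between the levels `-N` and `N`; the second index of `V` is taken
modulo `K`. -/
def meshArea (K : ℕ) (δ : ℤ → ℤ → Bool) (N : ℕ) (V : ℤ → ℤ → E3) : ℝ :=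
  ∑ n ∈ Finset.Ico (-(N : ℤ)) N, ∑ m ∈ Finset.range K, cellArea δ V n m

/-- The triangulated mesh with vertices `V n m` (`n ∈ ℤ`, `m` modulo `K`) is critical for area with
respect to all compactly supported smooth variations of its vertices. -/
def IsAreaCriticalMesh (K : ℕ) (δ : ℤ → ℤ → Bool) (V : ℤ → ℤ → E3) : Prop :=
  ∀ (N : ℕ) (W : ℝ → ℤ → ℤ → E3),
    (∀ n m, ContDiff ℝ ∞ (fun ε => W ε n m)) →
    (∀ ε n m, W ε n (m + K) = W ε n m) →
    (∀ n m, W 0 n m = V n m) →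
    (∀ ε n m, (N : ℤ) ≤ |n| → W ε n m = V n m) →
    HasDerivAt (fun ε => meshArea K δ N (W ε)) 0 0

/-- Profile curves of the Polthier-Rossman catenoids with dihedral angle `2π/K` and vertical
spacing `ℓ` (triangulated along the diagonals `δ`), with a neck vertex and neck radius `1`. -/
def PRProfiles (K : ℕ) (δ : ℤ → ℤ → Bool) (ℓ : ℝ) : Set (ℤ → E3) :=
  {p | ∃ x : ℤ → ℝ, (∀ n, 0 < x n) ∧ x 0 = 1 ∧ (∀ n, x (-n) = x n) ∧
    IsAreaCriticalMesh K δ (rotMesh K ℓ x) ∧ p = discreteProfile ℓ x}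

/-! ### Area-critical piecewise conical surfaces -/

/-- Area of the truncated cone swept out by the segment from `(ρ₀, 0, z₀)` to `(ρ₁, 0, z₁)` when it
is rotated about the `x₃`-axis. -/
def frustumArea (ρ₀ z₀ ρ₁ z₁ : ℝ) : ℝ :=
  patchArea (fun s φ => rotPt (ρ₀ + s * (ρ₁ - ρ₀)) φ (z₀ + s * (z₁ - z₀))) 0 1 0 (2 * Real.pi)

/-- The surface of revolution whose profile is the polygon with vertices `(x n, 0, n ℓ)` is critical
for area with respect to all compactly supported smooth rotationally invariant variations, that is,
variations of the profile vertices in the `x₁x₃`-plane. -/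
def IsAreaCriticalConical (ℓ : ℝ) (x : ℤ → ℝ) : Prop :=
  ∀ (N : ℕ) (ρ z : ℝ → ℤ → ℝ),
    (∀ n, ContDiff ℝ ∞ (fun ε => ρ ε n)) → (∀ n, ContDiff ℝ ∞ (fun ε => z ε n)) →
    (∀ n, ρ 0 n = x n ∧ z 0 n = n * ℓ) →
    (∀ ε n, (N : ℤ) ≤ |n| → ρ ε n = x n ∧ z ε n = n * ℓ) →
    HasDerivAt (fun ε => ∑ n ∈ Finset.Ico (-(N : ℤ)) N,
      frustumArea (ρ ε n) (z ε n) (ρ ε (n + 1)) (z ε (n + 1))) 0 0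

/-- Profile curves of the Machigashira catenoids (discrete profile, smooth rotational direction)
with vertical spacing `ℓ`, with a neck vertex and neck radius `1`. -/
def MpdrsProfiles (ℓ : ℝ) : Set (ℤ → E3) :=
  {p | ∃ x : ℤ → ℝ, (∀ n, 0 < x n) ∧ x 0 = 1 ∧ (∀ n, x (-n) = x n) ∧
    IsAreaCriticalConical ℓ x ∧ p = discreteProfile ℓ x}

/-! ### Area-critical surfaces foliated by regular polygons -/

/-- Area of one of the `K` congruent pieces, between the heights `-r` and `r`: the piece consists of
the horizontal segments joining `(x t, 0, t)` to its image under the rotation by `2π/K`. -/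
def ruledPieceArea (K : ℕ) (r : ℝ) (x : ℝ → ℝ) : ℝ :=
  patchArea (fun u t => (1 - u) • rotPt (x t) 0 t + u • rotPt (x t) (2 * Real.pi / K) t) 0 1 (-r) r

/-- Every piece of the surface between heights `-r` and `r` is critical for area with respect to the
smooth rotationally invariant variations that fix its boundary. -/
def IsAreaCriticalRuled (K : ℕ) (x : ℝ → ℝ) : Prop :=
  ∀ (r : ℝ) (y : ℝ → ℝ → ℝ), 0 < r →
    ContDiff ℝ ∞ (fun q : ℝ × ℝ => y q.1 q.2) →
    (∀ t, y 0 t = x t) →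
    (∀ ε, y ε r = x r ∧ y ε (-r) = x (-r)) →
    HasDerivAt (fun ε => ruledPieceArea K r (y ε)) 0 0

/-- Profile curves of the Machigashira-type catenoids with smooth profile and discrete rotational
direction with angle `2π/K`, normalized at the neck. -/
def MpsrdProfiles (K : ℕ) : Set (ℝ → E3) :=
  {p | ∃ x : ℝ → ℝ, ContDiff ℝ ∞ x ∧ (∀ t, 0 < x t) ∧ x 0 = 1 ∧ deriv x 0 = 0 ∧
    IsAreaCriticalRuled K x ∧ p = graphProfile x}

/-! ### Affinely scaled graphs of the hyperbolic cosine -/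

/-- The graph of `cosh`, scaled by positive factors in the two coordinate directions of the
`x₁x₃`-plane. -/
def scaledCoshGraph (a b : ℝ) : Set E3 := {q | ∃ s : ℝ, q = !₂[a * Real.cosh s, 0, b * s]}

/-- All points of the curve `p` lie on one affinely scaled graph of `cosh`. -/
def LiesOnScaledCosh {ι : Type} (p : ι → E3) : Prop :=
  ∃ a b : ℝ, 0 < a ∧ 0 < b ∧ Set.range p ⊆ scaledCoshGraph a b

end Catenoids

end

namespace Catenoids

/-! Every type is governed by a finite-difference or differential equation that can be solved
explicitly, so the proof determines the set of profile curves in each case as a singleton (the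
lemmas `mem_PRProfiles_iff`, `mem_MpdrsProfiles_iff`, `mem_BPProfiles_iff`,
`mem_MWpdrsProfiles_iff`, `mem_MWpsrdProfiles_iff`, `mem_MpsrdProfiles_iff`). All comparisons then
concern hyperbolic cosines only.

Area-critical, discrete profile. Up to a constant factor, the first variation of area of a
triangulated mesh and of a conical surface is that of `∑ (xₙ + xₙ₊₁) √(ℓₙ² + c² (xₙ₊₁ - xₙ)²)`,
where `c = cos (π/K)` for meshes and `c = 1` for cones. The diagonals play no role because each
quadrilateral is a planar trapezoid. Vertical variations make the ratio of `xₙ + xₙ₊₁` to the edge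
length constant; with this, horizontal variations give a linear recurrence, and the neck conditions
yield `xₙ = cosh (n a)` with `cosh a = 1 + ℓ² / (2 c²)`.

Integrable, discrete profile. Summing the Weierstrass edges gives radii `cosh (n c₁)` at heights `n
sinh c₁`. For the semi-discrete surface the dual lies on a sphere; after normalization its circles
have radius `1 / cosh s` and height `tanh s`, and duality makes `s` an arithmetic progression with
`sinh` of the step equal to `h`. Hence again `cosh (k a)`, now with `sinh a = h`.

Smooth profile. For the semi-discrete minimal surface the sphere condition on the dual integrates to
`f = cosh`. For the ruled surface area is a multiple of `∫ x √(1 + c² x'²)`, whose Euler-Lagrange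
equation gives `cosh (t / c)` with `c = cos (π/K)`.

Comparison. A point set with positive spacing determines the spacing and the radius of the first
vertex after the neck. This radius is `√(1 + h²)` in the integrable case and `1 + ℓ² / (2 c²)` in
the variational case. Since `√(1 + ℓ²) < 1 + ℓ² / 2 < 1 + ℓ² / (2 c²)` for `0 < c < 1`, the classes
are disjoint; the limits follow from `cos (π/K) → 1`. Throughout, `Real.sin (c₂ / 2) ≠ 0` encodes
that the angle is not a multiple of `2π`. -/

lemma inner_E3 (v w : E3) : inner ℝ v w = v 0 * w 0 + v 1 * w 1 + v 2 * w 2 := by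
  simp [PiLp.inner_apply, Fin.sum_univ_three, mul_comm]

lemma norm_sq_E3 (v : E3) : ‖v‖ ^ 2 = v 0 ^ 2 + v 1 ^ 2 + v 2 ^ 2 := by
  rw [← real_inner_self_eq_norm_sq, inner_E3]; ring

lemma ext_E3 {v w : E3} (h0 : v 0 = w 0) (h1 : v 1 = w 1) (h2 : v 2 = w 2) : v = w := by
  ext i; fin_cases i <;> assumption

lemma parallelogramArea_eq_of_inner_eq_zero {v w : E3} (h : inner ℝ v w = 0) :
    parallelogramArea v w = ‖v‖ * ‖w‖ := by
  rw [parallelogramArea, h, ← mul_pow]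
  simp [Real.sqrt_sq (mul_nonneg (norm_nonneg v) (norm_nonneg w))]

/-! ### The reduced first variation -/

/-- The length of the edge from `(x n, n ℓ)` to `(x (n + 1), (n + 1) ℓ)` after scaling the
horizontal direction by `c`. -/
noncomputable def edgeLength (c ℓ : ℝ) (x : ℤ → ℝ) (n : ℤ) : ℝ :=
  √(ℓ ^ 2 + c ^ 2 * (x (n + 1) - x n) ^ 2)

/-- The ratio of the sum of two consecutive radii and the length of the edge. -/
noncomputable def edgeRatio (c ℓ : ℝ) (x : ℤ → ℝ) (n : ℤ) : ℝ :=
  (x n + x (n + 1)) / edgeLength c ℓ x n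

/-- The contribution of one edge to the first variation of `∑ (xₙ + xₙ₊₁) √(ℓₙ² + c² (xₙ₊₁ - xₙ)²)`. -/
noncomputable def edgeVariation (c ℓ : ℝ) (x u v : ℤ → ℝ) (n : ℤ) : ℝ :=
  edgeLength c ℓ x n * (u n + u (n + 1)) +
    edgeRatio c ℓ x n * (c ^ 2 * (x (n + 1) - x n) * (u (n + 1) - u n) + ℓ * (v (n + 1) - v n))

/-- The first variation vanishes for all compactly supported variations of the profile. -/
def IsStationary (c ℓ : ℝ) (x : ℤ → ℝ) : Prop :=
  ∀ (N : ℕ) (u v : ℤ → ℝ), (∀ n, (N : ℤ) ≤ |n| → u n = 0 ∧ v n = 0) →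
    ∑ n ∈ Finset.Ico (-(N : ℤ)) N, edgeVariation c ℓ x u v n = 0

lemma sum_Ico_succ_eq (N : ℕ) (g : ℤ → ℝ) (h : g (-N) = g N) :
    ∑ n ∈ Finset.Ico (-(N : ℤ)) N, g (n + 1) = ∑ n ∈ Finset.Ico (-(N : ℤ)) N, g n := by
  rw [Finset.sum_Ico_add']
  have h1 : insert (-(N : ℤ)) (Finset.Ico (-(N : ℤ) + 1) (N + 1)) =
      insert (N : ℤ) (Finset.Ico (-(N : ℤ)) N) := by
    ext k; simp only [Finset.mem_insert, Finset.mem_Ico]; omega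
  have h2 := congrArg (fun s => ∑ n ∈ s, g n) h1
  rw [Finset.sum_insert (by simp), Finset.sum_insert (by simp), h] at h2
  linarith

/-- The coefficient of the horizontal variation of the `n`-th vertex. -/
noncomputable def radialCoeff (c ℓ : ℝ) (x : ℤ → ℝ) (n : ℤ) : ℝ :=
  edgeLength c ℓ x n + edgeLength c ℓ x (n - 1) -
    c ^ 2 * (edgeRatio c ℓ x n * (x (n + 1) - x n) - edgeRatio c ℓ x (n - 1) * (x n - x (n - 1)))

/-- Summation by parts: the part of each edge term that belongs to the upper endpoint is moved to
the next index, with no boundary term because the variation vanishes at `±N`. -/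
lemma sum_edgeVariation (c ℓ : ℝ) (x u v : ℤ → ℝ) (N : ℕ)
    (h : ∀ n, (N : ℤ) ≤ |n| → u n = 0 ∧ v n = 0) :
    ∑ n ∈ Finset.Ico (-(N : ℤ)) N, edgeVariation c ℓ x u v n =
      ∑ n ∈ Finset.Ico (-(N : ℤ)) N,
        (radialCoeff c ℓ x n * u n + ℓ * (edgeRatio c ℓ x (n - 1) - edgeRatio c ℓ x n) * v n) := by
  set D := edgeLength c ℓ x
  set Q := edgeRatio c ℓ x
  have hu := sum_Ico_succ_eq N
    (fun n => (D (n - 1) + c ^ 2 * Q (n - 1) * (x n - x (n - 1))) * u n + ℓ * Q (n - 1) * v n)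
    (by simp [h (-N) (by simp), h N (by simp)])
  rw [← sub_eq_zero, ← Finset.sum_sub_distrib] at hu ⊢
  rw [← hu]
  refine Finset.sum_congr rfl fun n _ => ?_
  simp only [edgeVariation, radialCoeff, add_sub_cancel_right]
  ring

/-- Testing with variations of a single vertex separates the two directions. The vertical equation
is a conservation law for `edgeRatio`, coming from invariance under vertical translation. -/
lemma isStationary_iff {c ℓ : ℝ} (hℓ : 0 < ℓ) {x : ℤ → ℝ} :
    IsStationary c ℓ x ↔
      ∀ n, radialCoeff c ℓ x n = 0 ∧ edgeRatio c ℓ x (n - 1) = edgeRatio c ℓ x n := by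
  constructor
  · intro h n
    have key : ∀ a b : ℝ, radialCoeff c ℓ x n * a +
        ℓ * (edgeRatio c ℓ x (n - 1) - edgeRatio c ℓ x n) * b = 0 := by
      intro a b
      have hs : ∀ k, ((n.natAbs + 1 : ℕ) : ℤ) ≤ |k| →
          (if k = n then a else 0) = 0 ∧ (if k = n then b else 0) = 0 := by
        intro k hk
        have : k ≠ n := by rintro rfl; push_cast at hk; omega
        simp [this]
      -- The bound must exceed `|n|` strictly, because vertices at levels `±N` are held fixed.
      have h1 := h (n.natAbs + 1) _ _ hs
      rw [sum_edgeVariation _ _ _ _ _ _ hs, Finset.sum_eq_single n] at h1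
      · simpa using h1
      · intro k _ hk; simp [hk]
      · intro hn; exfalso; apply hn; simp only [Finset.mem_Ico]; push_cast; grind
    refine ⟨by simpa using key 1 0, ?_⟩
    have := key 0 1
    simp only [mul_zero, mul_one, zero_add, mul_eq_zero, hℓ.ne', false_or] at this
    linarith
  · intro h N u v hs
    rw [sum_edgeVariation _ _ _ _ _ _ hs]
    exact Finset.sum_eq_zero fun n _ => by simp [(h n).1, (h n).2]

/-! ### Discrete hyperbolic cosines -/

/-- The radii of a discrete catenoid. -/
noncomputable def discreteCosh (a : ℝ) (n : ℤ) : ℝ := Real.cosh (n * a)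

lemma discreteCosh_pos (a : ℝ) (n : ℤ) : 0 < discreteCosh a n := Real.cosh_pos _

lemma discreteCosh_add_sub (a : ℝ) (n : ℤ) :
    discreteCosh a (n + 1) + discreteCosh a (n - 1) = 2 * discreteCosh a 1 * discreteCosh a n := by
  simp only [discreteCosh]; push_cast
  rw [show ((n : ℝ) + 1) * a = n * a + a by ring, show ((n : ℝ) - 1) * a = n * a - a by ring,
    Real.cosh_add, Real.cosh_sub]
  ring_nf

lemma eq_discreteCosh {a : ℝ} {x : ℤ → ℝ} (h0 : x 0 = 1) (heven : ∀ n, x (-n) = x n)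
    (h1 : x 1 = Real.cosh a) (hrec : ∀ n, x (n + 1) + x (n - 1) = 2 * x 1 * x n) :
    x = discreteCosh a := by
  have hd1 : discreteCosh a 1 = Real.cosh a := by simp [discreteCosh]
  have key : ∀ n : ℕ, x n = discreteCosh a n ∧ x (n + 1) = discreteCosh a (n + 1) := by
    intro n
    induction n with
    | zero => simp [h0, h1, discreteCosh]
    | succ n ih =>
      refine ⟨by push_cast; exact ih.2, ?_⟩
      have e1 := hrec (n + 1)
      have e2 := discreteCosh_add_sub a (n + 1)
      simp only [add_sub_cancel_right] at e1 e2
      rw [ih.1, ih.2, h1] at e1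
      rw [hd1] at e2
      push_cast
      linarith
  funext n
  rcases Int.natAbs_eq n with h | h
  · rw [h]; exact (key _).1
  · rw [h, heven, (key _).1]; simp [discreteCosh]

/-- With half steps centred at the midpoint of an edge, sum and edge length are both multiples of
`cosh ((2 n + 1) b)`, so their ratio does not depend on the edge. -/
lemma isStationary_discreteCosh {c ℓ : ℝ} (hc : 0 < c) (hℓ : 0 < ℓ) :
    IsStationary c ℓ (discreteCosh (Real.arcosh (1 + ℓ ^ 2 / (2 * c ^ 2)))) := by
  have hX : 1 < 1 + ℓ ^ 2 / (2 * c ^ 2) := by have : 0 < ℓ ^ 2 / (2 * c ^ 2) := by positivity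
                                              linarith
  have hcosh := Real.cosh_arcosh hX.le
  have hapos := Real.arcosh_pos hX
  generalize Real.arcosh (1 + ℓ ^ 2 / (2 * c ^ 2)) = a at *
  obtain ⟨b, rfl⟩ : ∃ b, a = 2 * b := ⟨a / 2, by ring⟩
  have hb : 0 < b := by linarith
  have hs : 0 < Real.sinh b := Real.sinh_pos_iff.2 hb
  have hcs : Real.cosh b ^ 2 = Real.sinh b ^ 2 + 1 := Real.cosh_sq b
  -- This is `cosh (2 b) - 1 = 2 sinh² b` applied to the choice of `a = 2 b`.
  have hℓ2 : ℓ ^ 2 = 4 * c ^ 2 * Real.sinh b ^ 2 := by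
    rw [Real.cosh_two_mul, hcs] at hcosh
    field_simp at hcosh
    linarith
  rw [isStationary_iff hℓ]
  have hx : ∀ n : ℤ, discreteCosh (2 * b) n = Real.cosh ((2 * n + 1) * b) * Real.cosh b -
      Real.sinh ((2 * n + 1) * b) * Real.sinh b := by
    intro n; rw [discreteCosh, ← Real.cosh_sub]; ring_nf
  have hx1 : ∀ n : ℤ, discreteCosh (2 * b) (n + 1) = Real.cosh ((2 * n + 1) * b) * Real.cosh b +
      Real.sinh ((2 * n + 1) * b) * Real.sinh b := by
    intro n; rw [discreteCosh, ← Real.cosh_add]; push_cast; ring_nf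
  have hD : ∀ n, edgeLength c ℓ (discreteCosh (2 * b)) n =
      2 * c * Real.sinh b * Real.cosh ((2 * n + 1) * b) := by
    intro n
    have h2 : Real.cosh ((2 * n + 1) * b) ^ 2 = Real.sinh ((2 * n + 1) * b) ^ 2 + 1 :=
      Real.cosh_sq _
    rw [edgeLength, hx1, hx, hℓ2]
    rw [show 4 * c ^ 2 * Real.sinh b ^ 2 + c ^ 2 *
      (Real.cosh ((2 * n + 1) * b) * Real.cosh b + Real.sinh ((2 * n + 1) * b) * Real.sinh b -
      (Real.cosh ((2 * n + 1) * b) * Real.cosh b - Real.sinh ((2 * n + 1) * b) * Real.sinh b)) ^ 2 =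
      (2 * c * Real.sinh b * Real.cosh ((2 * n + 1) * b)) ^ 2 by
        rw [mul_pow _ (Real.cosh _), h2]; ring]
    exact Real.sqrt_sq (by have := Real.cosh_pos ((2 * n + 1) * b); positivity)
  have hQ : ∀ n, edgeRatio c ℓ (discreteCosh (2 * b)) n = Real.cosh b / (c * Real.sinh b) := by
    intro n
    have := Real.cosh_pos ((2 * n + 1) * b)
    rw [edgeRatio, hD, hx, hx1]
    field_simp
    ring
  intro n
  refine ⟨?_, by rw [hQ, hQ]⟩
  have e2 := hx1 (n - 1)
  rw [sub_add_cancel] at e2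
  have e1 : discreteCosh (2 * b) n - discreteCosh (2 * b) (n - 1) =
      2 * Real.sinh ((2 * n - 1) * b) * Real.sinh b := by
    rw [e2, hx]; push_cast; ring_nf
  have e3 : discreteCosh (2 * b) (n + 1) - discreteCosh (2 * b) n =
      2 * Real.sinh ((2 * n + 1) * b) * Real.sinh b := by
    rw [hx1, hx]; ring
  rw [radialCoeff, hQ, hQ, hD, hD, e1, e3]
  have e5 : c * Real.sinh b ≠ 0 := by positivity
  push_cast
  rw [show (2 * (n : ℝ) + 1) * b = 2 * n * b + b by ring,
    show (2 * (n : ℝ) - 1) * b = 2 * n * b - b by ring,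
    show (2 * ((n : ℝ) - 1) + 1) * b = 2 * n * b - b by ring, Real.cosh_add, Real.cosh_sub,
    Real.sinh_add, Real.sinh_sub]
  field_simp
  ring

/-- The conserved ratio `κ` turns edge lengths into sums of radii, so the nonlinear radial equation
becomes a linear recurrence with coefficient `c² κ²`. Symmetry at the neck fixes both `κ` and `x 1`.
-/
lemma eq_discreteCosh_of_isStationary {c ℓ : ℝ} (hc : 0 < c) (hℓ : 0 < ℓ) {x : ℤ → ℝ}
    (hx : ∀ n, 0 < x n) (h0 : x 0 = 1) (heven : ∀ n, x (-n) = x n) (hst : IsStationary c ℓ x) :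
    x = discreteCosh (Real.arcosh (1 + ℓ ^ 2 / (2 * c ^ 2))) := by
  rw [isStationary_iff hℓ] at hst
  have hDpos : ∀ n, 0 < edgeLength c ℓ x n := fun n => Real.sqrt_pos.2 (by positivity)
  have hDsq : ∀ n, edgeLength c ℓ x n ^ 2 = ℓ ^ 2 + c ^ 2 * (x (n + 1) - x n) ^ 2 :=
    fun n => Real.sq_sqrt (by positivity)
  obtain ⟨κ, hκ⟩ : ∃ κ, ∀ n, edgeRatio c ℓ x n = κ := by
    refine ⟨edgeRatio c ℓ x 0, fun n => ?_⟩
    induction n using Int.induction_on with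
    | zero => rfl
    | succ n ih => rw [← ih]; have := (hst (n + 1)).2; rw [add_sub_cancel_right] at this; exact this.symm
    | pred n ih => rw [← ih]; exact (hst _).2
  have hS : ∀ n, x n + x (n + 1) = κ * edgeLength c ℓ x n := by
    intro n; rw [← hκ n, edgeRatio]; field_simp [(hDpos n).ne']
  have hrec0 : ∀ n, x (n + 1) + 2 * x n + x (n - 1) =
      c ^ 2 * κ ^ 2 * (x (n + 1) - 2 * x n + x (n - 1)) := by
    intro n
    have h1 := (hst n).1
    have h2 := hS (n - 1)
    rw [radialCoeff, hκ, hκ] at h1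
    rw [sub_add_cancel] at h2
    linear_combination hS n + h2 + κ * h1
  -- The recurrence at the neck, where `x (-1) = x 1`.
  have hy1 : x 1 + 1 = c ^ 2 * κ ^ 2 * (x 1 - 1) := by
    have := hrec0 0
    rw [zero_add, zero_sub, heven, h0] at this
    linarith
  have hy2 : (x 1 + 1) ^ 2 = κ ^ 2 * (ℓ ^ 2 + c ^ 2 * (x 1 - 1) ^ 2) := by
    have h1 := hDsq 0
    have h2 := hS 0
    rw [zero_add, h0] at h1 h2
    rw [← h1, ← mul_pow, ← h2]; ring
  have hpos := hx 1
  have hy3 : x 1 = 1 + ℓ ^ 2 / (2 * c ^ 2) := by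
    -- Elimination of `κ²` between `hy1` and `hy2`.
    have h3 : (x 1 + 1) * (2 * c ^ 2 * (x 1 - 1)) = (x 1 + 1) * ℓ ^ 2 := by
      linear_combination (x 1 - 1) * c ^ 2 * hy2 - (c ^ 2 * (x 1 - 1) ^ 2 + ℓ ^ 2) * hy1
    have h4 := mul_left_cancel₀ (by linarith : x 1 + 1 ≠ 0) h3
    field_simp
    linarith
  have hX : 1 < 1 + ℓ ^ 2 / (2 * c ^ 2) := by have : 0 < ℓ ^ 2 / (2 * c ^ 2) := by positivity
                                              linarith
  refine eq_discreteCosh h0 heven (by rw [Real.cosh_arcosh hX.le, hy3]) fun n => ?_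
  have hne : x 1 - 1 ≠ 0 := by linarith
  -- Multiplying the recurrence by `x 1 - 1` and replacing `c² κ² (x 1 - 1)` by `x 1 + 1` removes
  -- `κ`.
  linear_combination (-1 / 2 : ℝ) * (x 1 - 1) * hrec0 n +
    (1 / 2 : ℝ) * (x (n + 1) - 2 * x n + x (n - 1)) * hy1

/-! ### Coordinatewise derivatives and the area of truncated cones -/

lemma hasDerivAt_E3 {a b c : ℝ → ℝ} {a' b' c' t : ℝ} (ha : HasDerivAt a a' t)
    (hb : HasDerivAt b b' t) (hc : HasDerivAt c c' t) :
    HasDerivAt (fun t => (!₂[a t, b t, c t] : E3)) !₂[a', b', c'] t := by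
  have h : HasDerivAt (fun t => ![a t, b t, c t]) ![a', b', c'] t := by
    rw [hasDerivAt_pi]
    intro i
    fin_cases i <;> simpa
  exact (EuclideanSpace.equiv (Fin 3) ℝ).symm.toContinuousLinearMap.hasFDerivAt.comp_hasDerivAt t h

lemma hasDerivAt_coord {f : ℝ → E3} {f' : E3} {t : ℝ} (h : HasDerivAt f f' t) (i : Fin 3) :
    HasDerivAt (fun t => f t i) (f' i) t :=
  (EuclideanSpace.proj (𝕜 := ℝ) i).hasFDerivAt.comp_hasDerivAt t h

lemma hasDerivAt_rotPt_angle (r φ z : ℝ) :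
    HasDerivAt (fun φ => rotPt r φ z) !₂[-(r * Real.sin φ), r * Real.cos φ, 0] φ := by
  refine hasDerivAt_E3 ?_ ((Real.hasDerivAt_sin φ).const_mul r) (hasDerivAt_const φ z)
  simpa using (Real.hasDerivAt_cos φ).const_mul r

lemma hasDerivAt_rotPt_profile {f z : ℝ → ℝ} {f' z' t : ℝ} (φ : ℝ) (hf : HasDerivAt f f' t)
    (hz : HasDerivAt z z' t) :
    HasDerivAt (fun t => rotPt (f t) φ (z t)) (rotPt f' φ z') t :=
  hasDerivAt_E3 (hf.mul_const _) (hf.mul_const _) hz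

/-- The generator and the circle direction are orthogonal, so the area density is the slant length
times the radius; positivity of both end radii keeps this radius positive along the segment. -/
lemma frustumArea_eq {ρ₀ z₀ ρ₁ z₁ : ℝ} (h₀ : 0 < ρ₀) (h₁ : 0 < ρ₁) :
    frustumArea ρ₀ z₀ ρ₁ z₁ = Real.pi * ((ρ₀ + ρ₁) * √((z₁ - z₀) ^ 2 + (ρ₁ - ρ₀) ^ 2)) := by
  have key : ∀ s ∈ Set.uIcc (0 : ℝ) 1, ∀ φ : ℝ,
      parallelogramArea
        (deriv (fun s' => rotPt (ρ₀ + s' * (ρ₁ - ρ₀)) φ (z₀ + s' * (z₁ - z₀))) s)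
        (deriv (fun φ' => rotPt (ρ₀ + s * (ρ₁ - ρ₀)) φ' (z₀ + s * (z₁ - z₀))) φ) =
      √((z₁ - z₀) ^ 2 + (ρ₁ - ρ₀) ^ 2) * (ρ₀ + s * (ρ₁ - ρ₀)) := by
    intro s hs φ
    rw [Set.uIcc_of_le zero_le_one] at hs
    have hρ : 0 < ρ₀ + s * (ρ₁ - ρ₀) := by
      rcases hs.1.eq_or_lt with rfl | h
      · simpa
      · nlinarith [mul_pos h h₁, mul_nonneg (sub_nonneg.2 hs.2) h₀.le]
    have hd1 : HasDerivAt (fun s' => ρ₀ + s' * (ρ₁ - ρ₀)) (ρ₁ - ρ₀) s := by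
      simpa using ((hasDerivAt_id s).mul_const (ρ₁ - ρ₀)).const_add ρ₀
    have hd2 : HasDerivAt (fun s' => z₀ + s' * (z₁ - z₀)) (z₁ - z₀) s := by
      simpa using ((hasDerivAt_id s).mul_const (z₁ - z₀)).const_add z₀
    rw [(hasDerivAt_rotPt_profile φ hd1 hd2).deriv, (hasDerivAt_rotPt_angle _ φ _).deriv,
      parallelogramArea_eq_of_inner_eq_zero]
    · congr 1
      · rw [← Real.sqrt_sq (norm_nonneg _), norm_sq_E3]
        congr 1
        simp [rotPt]
        linear_combination (ρ₁ - ρ₀) ^ 2 * Real.sin_sq_add_cos_sq φ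
      · refine (sq_eq_sq₀ (norm_nonneg _) hρ.le).1 ?_
        rw [norm_sq_E3]
        simp
        linear_combination (ρ₀ + s * (ρ₁ - ρ₀)) ^ 2 * Real.sin_sq_add_cos_sq φ
    · rw [inner_E3]; simp [rotPt]; ring
  rw [frustumArea, patchArea]
  have h1 : ∀ s ∈ Set.uIcc (0 : ℝ) 1, (∫ φ in (0 : ℝ)..(2 * Real.pi), parallelogramArea
        (deriv (fun s' => rotPt (ρ₀ + s' * (ρ₁ - ρ₀)) φ (z₀ + s' * (z₁ - z₀))) s)
        (deriv (fun φ' => rotPt (ρ₀ + s * (ρ₁ - ρ₀)) φ' (z₀ + s * (z₁ - z₀))) φ)) =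
      (2 * Real.pi * √((z₁ - z₀) ^ 2 + (ρ₁ - ρ₀) ^ 2)) * (ρ₀ + s * (ρ₁ - ρ₀)) := by
    intro s hs
    rw [intervalIntegral.integral_congr fun φ _ => key s hs φ]
    simp; ring
  rw [intervalIntegral.integral_congr h1, intervalIntegral.integral_const_mul,
    intervalIntegral.integral_add (by simp) (Continuous.intervalIntegrable (by fun_prop) _ _),
    intervalIntegral.integral_mul_const]
  simp
  ring

lemma hasDerivAt_frustumArea {ℓ : ℝ} (hℓ : 0 < ℓ) {x : ℤ → ℝ} (hx : ∀ n, 0 < x n)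
    {ρ z : ℝ → ℤ → ℝ} {u v : ℤ → ℝ} (hρ : ∀ n, HasDerivAt (fun ε => ρ ε n) (u n) 0)
    (hz : ∀ n, HasDerivAt (fun ε => z ε n) (v n) 0) (h0 : ∀ n, ρ 0 n = x n ∧ z 0 n = n * ℓ)
    (n : ℤ) :
    HasDerivAt (fun ε => frustumArea (ρ ε n) (z ε n) (ρ ε (n + 1)) (z ε (n + 1)))
      (Real.pi * edgeVariation 1 ℓ x u v n) 0 := by
  -- The closed formula for the area needs positive radii, which an arbitrary variation guarantees
  -- only for small `ε`.
  have hpos : ∀ k, ∀ᶠ ε in 𝓝 (0 : ℝ), 0 < ρ ε k := fun k =>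
    (hρ k).continuousAt.eventually_const_lt (by simpa [(h0 k).1] using hx k)
  have hD : edgeLength 1 ℓ x n = √((z 0 (n + 1) - z 0 n) ^ 2 + (ρ 0 (n + 1) - ρ 0 n) ^ 2) := by
    rw [(h0 n).1, (h0 n).2, (h0 (n + 1)).1, (h0 (n + 1)).2, edgeLength]
    push_cast; congr 1; ring
  have hDpos : 0 < edgeLength 1 ℓ x n := Real.sqrt_pos.2 (by positivity)
  have hne : (z 0 (n + 1) - z 0 n) ^ 2 + (ρ 0 (n + 1) - ρ 0 n) ^ 2 ≠ 0 := by
    intro h; rw [h, Real.sqrt_zero] at hD; exact hDpos.ne' hD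
  have hd := (((hρ n).add (hρ (n + 1))).mul (((((hz (n + 1)).sub (hz n)).pow 2).add
    (((hρ (n + 1)).sub (hρ n)).pow 2)).sqrt hne)).const_mul Real.pi
  refine (hd.congr_of_eventuallyEq ?_).congr_deriv ?_
  · filter_upwards [hpos n, hpos (n + 1)] with ε h1 h2
    rw [frustumArea_eq h1 h2]
    rfl
  · simp only [Pi.add_apply, Pi.sub_apply, Pi.pow_apply]
    rw [← hD, edgeVariation, edgeRatio, (h0 n).1, (h0 n).2, (h0 (n + 1)).1, (h0 (n + 1)).2]
    push_cast
    field_simp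
    ring

lemma isAreaCriticalConical_iff {ℓ : ℝ} (hℓ : 0 < ℓ) {x : ℤ → ℝ} (hx : ∀ n, 0 < x n) :
    IsAreaCriticalConical ℓ x ↔ IsStationary 1 ℓ x := by
  have key : ∀ (N : ℕ) (ρ z : ℝ → ℤ → ℝ) (u v : ℤ → ℝ),
      (∀ n, HasDerivAt (fun ε => ρ ε n) (u n) 0) → (∀ n, HasDerivAt (fun ε => z ε n) (v n) 0) →
      (∀ n, ρ 0 n = x n ∧ z 0 n = n * ℓ) →
      HasDerivAt (fun ε => ∑ n ∈ Finset.Ico (-(N : ℤ)) N,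
        frustumArea (ρ ε n) (z ε n) (ρ ε (n + 1)) (z ε (n + 1)))
        (Real.pi * ∑ n ∈ Finset.Ico (-(N : ℤ)) N, edgeVariation 1 ℓ x u v n) 0 := by
    intro N ρ z u v hρ hz h0
    rw [Finset.mul_sum]
    exact HasDerivAt.fun_sum fun n _ => hasDerivAt_frustumArea hℓ hx hρ hz h0 n
  constructor
  · intro h N u v hs
    have hd : ∀ a b : ℝ, HasDerivAt (fun ε : ℝ => a + ε * b) b 0 := fun a b => by
      simpa using ((hasDerivAt_id (0 : ℝ)).mul_const b).const_add a
    have h1 := h N (fun ε n => x n + ε * u n) (fun ε n => n * ℓ + ε * v n)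
      (fun n => by fun_prop) (fun n => by fun_prop) (fun n => by simp)
      (fun ε n hn => by simp [hs n hn])
    have h2 := key N (fun ε n => x n + ε * u n) (fun ε n => n * ℓ + ε * v n) u v
      (fun n => hd _ _) (fun n => hd _ _) (fun n => by simp)
    simpa [Real.pi_ne_zero] using h2.unique h1
  · intro h N ρ z hρ hz h0 hs
    have h1 := key N ρ z _ _ (fun n => ((hρ n).differentiable (by simp) 0).hasDerivAt)
      (fun n => ((hz n).differentiable (by simp) 0).hasDerivAt) h0
    rw [h N] at h1
    · simpa using h1
    · intro n hn
      simp [fun ε => (hs ε n hn).1, fun ε => (hs ε n hn).2]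

lemma mem_MpdrsProfiles_iff {ℓ : ℝ} (hℓ : 0 < ℓ) {p : ℤ → E3} :
    p ∈ MpdrsProfiles ℓ ↔
      p = discreteProfile ℓ (discreteCosh (Real.arcosh (1 + ℓ ^ 2 / (2 * 1 ^ 2)))) := by
  constructor
  · rintro ⟨x, hx, h0, heven, hcrit, rfl⟩
    rw [isAreaCriticalConical_iff hℓ hx] at hcrit
    rw [eq_discreteCosh_of_isStationary one_pos hℓ hx h0 heven hcrit]
  · rintro rfl
    refine ⟨discreteCosh _, discreteCosh_pos _, by simp [discreteCosh], fun n => by simp [discreteCosh], ?_,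
      rfl⟩
    exact (isAreaCriticalConical_iff hℓ (discreteCosh_pos _)).2 (isStationary_discreteCosh one_pos hℓ)

/-! ### Triangulated rotational meshes -/

/-- In an orthonormal frame of the initial plane the area is the determinant `a d - b c`. Components
of the variation normal to this plane do not enter at first order, so only the derivative of the
determinant remains. -/
lemma hasDerivAt_parallelogramArea {v w : ℝ → E3} {v' w' e f : E3} {a b c d : ℝ}
    (hv : HasDerivAt v v' 0) (hw : HasDerivAt w w' 0) (he : inner ℝ e e = 1)
    (hf : inner ℝ f f = 1) (hef : inner ℝ e f = 0) (hv0 : v 0 = a • e + b • f)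
    (hw0 : w 0 = c • e + d • f) (hpos : 0 < a * d - b * c) :
    HasDerivAt (fun ε => parallelogramArea (v ε) (w ε))
      (d * inner ℝ e v' - c * inner ℝ f v' + a * inner ℝ f w' - b * inner ℝ e w') 0 := by
  have hfe : inner ℝ f e = 0 := by rw [real_inner_comm, hef]
  have hvv : ‖v 0‖ ^ 2 = a ^ 2 + b ^ 2 := by
    rw [← real_inner_self_eq_norm_sq, hv0]
    simp only [inner_add_left, inner_add_right, real_inner_smul_left, real_inner_smul_right, he, hf,
      hef, hfe]
    ring
  have hww : ‖w 0‖ ^ 2 = c ^ 2 + d ^ 2 := by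
    rw [← real_inner_self_eq_norm_sq, hw0]
    simp only [inner_add_left, inner_add_right, real_inner_smul_left, real_inner_smul_right, he, hf,
      hef, hfe]
    ring
  have hvw : inner ℝ (v 0) (w 0) = a * c + b * d := by
    rw [hv0, hw0]
    simp only [inner_add_left, inner_add_right, real_inner_smul_left, real_inner_smul_right, he, hf,
      hef, hfe]
    ring
  have hA : ‖v 0‖ ^ 2 * ‖w 0‖ ^ 2 - inner ℝ (v 0) (w 0) ^ 2 = (a * d - b * c) ^ 2 := by
    rw [hvv, hww, hvw]; ring
  have hd := ((hv.norm_sq.mul hw.norm_sq).sub ((hv.inner ℝ hw).pow 2)).sqrt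
    (by simp only [Pi.mul_apply, Pi.sub_apply, Pi.pow_apply]; rw [hA]; positivity)
  refine hd.congr_deriv ?_
  simp only [Pi.mul_apply, Pi.sub_apply, Pi.pow_apply]
  rw [hA, Real.sqrt_sq hpos.le, hvv, hww, hvw, hv0, hw0]
  simp only [inner_add_left, real_inner_smul_left, inner_add_right, real_inner_smul_right,
    real_inner_comm e v', real_inner_comm f v']
  field_simp
  ring

lemma hasDerivAt_triangleArea {p q r : ℝ → E3} {p' q' r' e f : E3} {a b c d : ℝ}
    (hp : HasDerivAt p p' 0) (hq : HasDerivAt q q' 0) (hr : HasDerivAt r r' 0)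
    (he : inner ℝ e e = 1) (hf : inner ℝ f f = 1) (hef : inner ℝ e f = 0)
    (hq0 : q 0 - p 0 = a • e + b • f) (hr0 : r 0 - p 0 = c • e + d • f)
    (hpos : 0 < a * d - b * c) :
    HasDerivAt (fun ε => triangleArea (p ε) (q ε) (r ε))
      ((d * inner ℝ e (q' - p') - c * inner ℝ f (q' - p') + a * inner ℝ f (r' - p') -
        b * inner ℝ e (r' - p')) / 2) 0 :=
  (hasDerivAt_parallelogramArea (hq.sub hp) (hr.sub hp) he hf hef hq0 hr0 hpos).div_const 2

/-- The first variation of the area of a trapezoid with parallel sides of lengths `2 A`, `2 B` and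
with height `D` does not depend on the diagonal. -/
lemma hasDerivAt_cellArea (δ : ℤ → ℤ → Bool) {W : ℝ → ℤ → ℤ → E3} {W' : ℤ → ℤ → E3} {e f : E3}
    {A B D : ℝ} {n m : ℤ} (hW : ∀ n m, HasDerivAt (fun ε => W ε n m) (W' n m) 0)
    (he : inner ℝ e e = 1) (hf : inner ℝ f f = 1) (hef : inner ℝ e f = 0) (hA : 0 < A) (hB : 0 < B)
    (hD : 0 < D) (h01 : W 0 n (m + 1) - W 0 n m = (2 * A) • e)
    (h10 : W 0 (n + 1) m - W 0 n m = (A - B) • e + D • f)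
    (h11 : W 0 (n + 1) (m + 1) - W 0 n m = (A + B) • e + D • f) :
    HasDerivAt (fun ε => cellArea δ (W ε) n m)
      ((D * inner ℝ e (W' n (m + 1) - W' n m + (W' (n + 1) (m + 1) - W' (n + 1) m)) +
        (A + B) * inner ℝ f (W' (n + 1) m + W' (n + 1) (m + 1) - W' n m - W' n (m + 1))) / 2) 0 := by
  have hAD := mul_pos hA hD
  have hBD := mul_pos hB hD
  have h01' : W 0 n (m + 1) - W 0 n m = (2 * A) • e + (0 : ℝ) • f := by rw [h01]; simp
  -- For either diagonal the two triangles fill the same planar trapezoid. To first order only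
  -- in-plane displacements count, and these change the area enclosed by the boundary independently
  -- of the diagonal.
  by_cases hδ : δ n m = true
  · simp only [cellArea, hδ, if_true]
    have t1 := hasDerivAt_triangleArea (hW n m) (hW n (m + 1)) (hW (n + 1) (m + 1)) he hf hef h01'
      h11 (by nlinarith)
    have t2 := hasDerivAt_triangleArea (hW n m) (hW (n + 1) (m + 1)) (hW (n + 1) m) he hf hef h11
      h10 (by nlinarith)
    refine (t1.add t2).congr_deriv ?_
    simp only [inner_sub_right, inner_add_right]
    ring
  · simp only [cellArea, hδ]
    have h3 : W 0 (n + 1) (m + 1) - W 0 n (m + 1) = (B - A) • e + D • f := by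
      rw [← sub_sub_sub_cancel_right _ _ (W 0 n m), h11, h01]; module
    have h4 : W 0 (n + 1) m - W 0 n (m + 1) = (-(A + B)) • e + D • f := by
      rw [← sub_sub_sub_cancel_right _ _ (W 0 n m), h10, h01]; module
    have t1 := hasDerivAt_triangleArea (hW n m) (hW n (m + 1)) (hW (n + 1) m) he hf hef h01'
      h10 (by nlinarith)
    have t2 := hasDerivAt_triangleArea (hW n (m + 1)) (hW (n + 1) (m + 1)) (hW (n + 1) m) he hf hef
      h3 h4 (by nlinarith)
    refine (t1.add t2).congr_deriv ?_
    simp only [inner_sub_right, inner_add_right]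
    ring

lemma edgeVariation_sum (c ℓ : ℝ) (x : ℤ → ℝ) (K : ℕ) (u v : ℕ → ℤ → ℝ) (n : ℤ) :
    edgeVariation c ℓ x (fun n => ∑ m ∈ Finset.range K, u m n)
      (fun n => ∑ m ∈ Finset.range K, v m n) n =
      ∑ m ∈ Finset.range K, edgeVariation c ℓ x (u m) (v m) n := by
  simp only [edgeVariation, ← Finset.sum_add_distrib, ← Finset.sum_sub_distrib, Finset.mul_sum]

lemma sum_range_succ_eq_of_eq {K : ℕ} (g : ℕ → ℝ) (h : g K = g 0) :
    ∑ m ∈ Finset.range K, g (m + 1) = ∑ m ∈ Finset.range K, g m := by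
  have h1 := Finset.sum_range_succ g K
  rw [Finset.sum_range_succ', h] at h1
  linarith

lemma pos_sin_pi_div {K : ℕ} (hK : 3 ≤ K) : 0 < Real.sin (Real.pi / K) := by
  have hK' : (3 : ℝ) ≤ K := by exact_mod_cast hK
  refine Real.sin_pos_of_pos_of_lt_pi (by positivity) ?_
  rw [div_lt_iff₀ (by positivity)]
  nlinarith [Real.pi_pos]

lemma pos_cos_pi_div {K : ℕ} (hK : 3 ≤ K) : 0 < Real.cos (Real.pi / K) := by
  have hK' : (3 : ℝ) ≤ K := by exact_mod_cast hK
  refine Real.cos_pos_of_mem_Ioo ⟨?_, ?_⟩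
  · have : 0 < Real.pi / K := by positivity
    linarith [Real.pi_pos]
  · rw [div_lt_div_iff₀ (by positivity) two_pos]
    nlinarith [Real.pi_pos]

lemma cos_pi_div_lt_one {K : ℕ} (hK : 3 ≤ K) : Real.cos (Real.pi / K) < 1 := by
  have := pos_sin_pi_div hK
  nlinarith [Real.sin_sq_add_cos_sq (Real.pi / K), Real.cos_le_one (Real.pi / K)]

/-- The radial component of the variation of the `m`-th vertex of a horizontal polygon. -/
noncomputable def radialPart (K : ℕ) (m : ℤ) (w : E3) : ℝ :=
  Real.cos (2 * Real.pi * m / K) * w 0 + Real.sin (2 * Real.pi * m / K) * w 1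

/-- `ψ` is the azimuth of the midline of the cell. The horizontal sides have half-lengths `sin (π/K)
x` and their midpoints are at distance `cos (π/K) x` from the axis; hence the height of the
trapezoid is `edgeLength` with `c = cos (π/K)`. -/
lemma hasDerivAt_cellArea_rotMesh {K : ℕ} (hK : 3 ≤ K) {ℓ : ℝ} (hℓ : 0 < ℓ) {x : ℤ → ℝ}
    (hx : ∀ n, 0 < x n) (δ : ℤ → ℤ → Bool) {W : ℝ → ℤ → ℤ → E3} {W' : ℤ → ℤ → E3}
    (hW : ∀ n m, HasDerivAt (fun ε => W ε n m) (W' n m) 0)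
    (hW0 : ∀ n m, W 0 n m = rotMesh K ℓ x n m) (n m : ℤ) (ψ : ℝ)
    (hψ : ψ = 2 * Real.pi * m / K + Real.pi / K) :
    HasDerivAt (fun ε => cellArea δ (W ε) n m)
      ((edgeLength (Real.cos (Real.pi / K)) ℓ x n *
        inner ℝ (!₂[-Real.sin ψ, Real.cos ψ, 0] : E3)
          (W' n (m + 1) - W' n m + (W' (n + 1) (m + 1) - W' (n + 1) m)) +
        Real.sin (Real.pi / K) * edgeRatio (Real.cos (Real.pi / K)) ℓ x n *
        inner ℝ (!₂[Real.cos (Real.pi / K) * (x (n + 1) - x n) * Real.cos ψ,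
          Real.cos (Real.pi / K) * (x (n + 1) - x n) * Real.sin ψ, ℓ] : E3)
          (W' (n + 1) m + W' (n + 1) (m + 1) - W' n m - W' n (m + 1))) / 2) 0 := by
  have hK' : (K : ℝ) ≠ 0 := by positivity
  have hs := pos_sin_pi_div hK
  have e0 : 2 * Real.pi * m / K = ψ - Real.pi / K := by rw [hψ]; ring
  have e1 : 2 * Real.pi * (m + 1 : ℤ) / K = ψ + Real.pi / K := by rw [hψ]; push_cast; ring
  set s := Real.sin (Real.pi / K) with hsdef
  set c := Real.cos (Real.pi / K) with hcdef
  set D := edgeLength c ℓ x n with hDdef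
  have hDpos : 0 < D := Real.sqrt_pos.2 (by positivity)
  have hDsq : D ^ 2 = ℓ ^ 2 + c ^ 2 * (x (n + 1) - x n) ^ 2 := Real.sq_sqrt (by positivity)
  -- The vector joining the midpoints of the two horizontal sides; its length is `D`.
  set g : E3 := !₂[c * (x (n + 1) - x n) * Real.cos ψ, c * (x (n + 1) - x n) * Real.sin ψ, ℓ]
    with hg
  have hsc := Real.sin_sq_add_cos_sq ψ
  have h := hasDerivAt_cellArea δ (e := !₂[-Real.sin ψ, Real.cos ψ, 0]) (f := D⁻¹ • g)
    (A := s * x n) (B := s * x (n + 1)) (D := D) (n := n) (m := m) hW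
    (by rw [inner_E3]; simp only [Matrix.cons_val]; linarith)
    (by
      rw [real_inner_smul_left, real_inner_smul_right, inner_E3]
      simp only [hg, PiLp.toLp_apply, Matrix.cons_val]
      field_simp
      rw [hDsq]
      linear_combination (c ^ 2 * (x (n + 1) - x n) ^ 2) * hsc)
    (by rw [real_inner_smul_right, inner_E3]; simp [hg]; right; ring)
    (mul_pos hs (hx _)) (mul_pos hs (hx _)) hDpos
    (by
      rw [hW0, hW0, rotMesh, rotMesh, e0, e1]
      apply ext_E3 <;> simp [rotPt, Real.cos_add, Real.cos_sub, Real.sin_add, Real.sin_sub, ← hsdef,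
        ← hcdef] <;> ring)
    (by
      rw [hW0, hW0, rotMesh, rotMesh, e0, smul_inv_smul₀ hDpos.ne']
      apply ext_E3 <;> simp [rotPt, hg, Real.cos_sub, Real.sin_sub, ← hsdef,
        ← hcdef] <;> ring)
    (by
      rw [hW0, hW0, rotMesh, rotMesh, e0, e1, smul_inv_smul₀ hDpos.ne']
      apply ext_E3 <;> simp [rotPt, hg, Real.cos_add, Real.cos_sub, Real.sin_add, Real.sin_sub,
        ← hsdef, ← hcdef] <;> ring)
  refine h.congr_deriv ?_
  rw [real_inner_smul_left, edgeRatio, ← hDdef]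
  ring

/-- At each vertex the two adjacent cells contribute opposite unit tangents along their sides, whose
sum points radially with factor `2 sin (π/K)`, while their slope vectors average to one more factor
`cos (π/K)` in the radial direction. The tangential parts cancel, so an arbitrary variation enters
only through its radial and vertical components summed over the ring. -/
lemma hasDerivAt_ringArea {K : ℕ} (hK : 3 ≤ K) {ℓ : ℝ} (hℓ : 0 < ℓ) {x : ℤ → ℝ}
    (hx : ∀ n, 0 < x n) (δ : ℤ → ℤ → Bool) {W : ℝ → ℤ → ℤ → E3} {W' : ℤ → ℤ → E3}
    (hW : ∀ n m, HasDerivAt (fun ε => W ε n m) (W' n m) 0)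
    (hW0 : ∀ n m, W 0 n m = rotMesh K ℓ x n m) (hper : ∀ n, W' n K = W' n 0) (n : ℤ) :
    HasDerivAt (fun ε => ∑ m ∈ Finset.range K, cellArea δ (W ε) n m)
      (Real.sin (Real.pi / K) * edgeVariation (Real.cos (Real.pi / K)) ℓ x
        (fun n => ∑ m ∈ Finset.range K, radialPart K m (W' n m))
        (fun n => ∑ m ∈ Finset.range K, W' n m 2) n) 0 := by
  have hK' : (K : ℝ) ≠ 0 := by positivity
  have h := HasDerivAt.fun_sum (u := Finset.range K)
    fun m _ => hasDerivAt_cellArea_rotMesh hK hℓ hx δ hW hW0 n m _ rfl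
  refine h.congr_deriv ?_
  rw [edgeVariation_sum, Finset.mul_sum]
  set c := Real.cos (Real.pi / K) with hc
  set s := Real.sin (Real.pi / K) with hs
  -- Cyclic shift that reassigns to the vertex `m` what the cell on its other side contributes; the
  -- index `K` agrees with `0` because the angle grows by `2π`.
  have hR := sum_range_succ_eq_of_eq (K := K) (fun m : ℕ =>
    (edgeLength c ℓ x n * inner ℝ (!₂[-Real.sin (2 * Real.pi * m / K - Real.pi / K),
        Real.cos (2 * Real.pi * m / K - Real.pi / K), 0] : E3) (W' n m + W' (n + 1) m) +
      s * edgeRatio c ℓ x n * inner ℝ (!₂[c * (x (n + 1) - x n) * Real.cos (2 * Real.pi * m / K - Real.pi / K),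
        c * (x (n + 1) - x n) * Real.sin (2 * Real.pi * m / K - Real.pi / K), ℓ] : E3)
        (W' (n + 1) m - W' n m)) / 2)
    (by
      have e : 2 * Real.pi * (K : ℝ) / K - Real.pi / K = -(Real.pi / K) + 2 * Real.pi := by
        field_simp; ring
      simp [e, hper])
  rw [← sub_eq_zero, ← Finset.sum_sub_distrib] at hR ⊢
  refine (Finset.sum_congr rfl fun m _ => ?_).trans hR
  have e1 : 2 * Real.pi * ((m + 1 : ℕ) : ℝ) / K - Real.pi / K =
      2 * Real.pi * m / K + Real.pi / K := by push_cast; field_simp; ring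
  simp only [e1]
  simp only [inner_E3, edgeVariation, radialPart, Matrix.cons_val, PiLp.add_apply,
    PiLp.sub_apply, Real.cos_add, Real.cos_sub, Real.sin_add, Real.sin_sub, ← hs, ← hc,
    Int.cast_natCast, Nat.cast_add, Nat.cast_one]
  generalize Real.cos (2 * Real.pi * m / K) = C
  generalize Real.sin (2 * Real.pi * m / K) = S
  ring

/-- Symmetric criticality: the derivative along any variation equals the reduced first variation at
its ring sums, and conversely rotationally symmetric variations realize every reduced variation up
to the factor `K`. -/
lemma isAreaCriticalMesh_rotMesh_iff {K : ℕ} (hK : 3 ≤ K) {ℓ : ℝ} (hℓ : 0 < ℓ) {x : ℤ → ℝ}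
    (hx : ∀ n, 0 < x n) (δ : ℤ → ℤ → Bool) :
    IsAreaCriticalMesh K δ (rotMesh K ℓ x) ↔ IsStationary (Real.cos (Real.pi / K)) ℓ x := by
  have hK' : (K : ℝ) ≠ 0 := by positivity
  have key : ∀ (N : ℕ) (W : ℝ → ℤ → ℤ → E3) (W' : ℤ → ℤ → E3),
      (∀ n m, HasDerivAt (fun ε => W ε n m) (W' n m) 0) →
      (∀ n m, W 0 n m = rotMesh K ℓ x n m) → (∀ n, W' n K = W' n 0) →
      HasDerivAt (fun ε => meshArea K δ N (W ε))
        (Real.sin (Real.pi / K) * ∑ n ∈ Finset.Ico (-(N : ℤ)) N,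
          edgeVariation (Real.cos (Real.pi / K)) ℓ x
            (fun n => ∑ m ∈ Finset.range K, radialPart K m (W' n m))
            (fun n => ∑ m ∈ Finset.range K, W' n m 2) n) 0 := by
    intro N W W' hW hW0 hper
    rw [Finset.mul_sum]
    exact HasDerivAt.fun_sum fun n _ => hasDerivAt_ringArea hK hℓ hx δ hW hW0 hper n
  have hangle : ∀ m : ℤ, 2 * Real.pi * ((m + K : ℤ) : ℝ) / K = 2 * Real.pi * m / K + 2 * Real.pi := by
    intro m; push_cast; field_simp
  constructor
  · intro h N u v hs
    have hd : ∀ a b : ℝ, HasDerivAt (fun ε : ℝ => a + ε * b) b 0 := fun a b => by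
      simpa using ((hasDerivAt_id (0 : ℝ)).mul_const b).const_add a
    have h1 := h N (fun ε n m => rotPt (x n + ε * u n) (2 * Real.pi * m / K) (n * ℓ + ε * v n))
      (fun n m => by
        rw [contDiff_euclidean]
        intro i
        fin_cases i <;> simp [rotPt] <;> fun_prop)
      (fun ε n m => by simp only [rotPt, hangle, Real.cos_add_two_pi, Real.sin_add_two_pi])
      (fun n m => by simp [rotMesh])
      (fun ε n m hn => by simp [hs n hn, rotMesh])
    have h2 := key N (fun ε n m => rotPt (x n + ε * u n) (2 * Real.pi * m / K) (n * ℓ + ε * v n))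
      (fun n m => rotPt (u n) (2 * Real.pi * m / K) (v n))
      (fun n m => hasDerivAt_rotPt_profile _ (hd _ _) (hd _ _)) (fun n m => by simp [rotMesh])
      (fun n => by
        have := hangle 0
        rw [zero_add] at this
        simp only [rotPt, this, Real.cos_add_two_pi, Real.sin_add_two_pi])
    have h3 := h2.unique h1
    rw [mul_eq_zero, or_iff_right (pos_sin_pi_div hK).ne'] at h3
    have hrad : ∀ (n : ℤ) (m : ℕ), radialPart K m (rotPt (u n) (2 * Real.pi * (m : ℤ) / K) (v n)) =
        u n := by
      intro n m
      simp only [radialPart, rotPt, Matrix.cons_val]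
      linear_combination u n * Real.sin_sq_add_cos_sq (2 * Real.pi * (m : ℤ) / K)
    have hver : ∀ (n : ℤ) (m : ℕ), rotPt (u n) (2 * Real.pi * (m : ℤ) / K) (v n) 2 = v n :=
      fun n m => rfl
    simp only [hrad, hver, Finset.sum_const, Finset.card_range, nsmul_eq_mul] at h3
    have h4 : ∀ n, edgeVariation (Real.cos (Real.pi / K)) ℓ x (fun n => K * u n) (fun n => K * v n) n
        = K * edgeVariation (Real.cos (Real.pi / K)) ℓ x u v n := by
      intro n; simp only [edgeVariation]; ring
    simp only [h4, ← Finset.mul_sum] at h3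
    exact (mul_eq_zero.1 h3).resolve_left hK'
  · intro h N W hW hper h0 hs
    have h1 := key N W (fun n m => deriv (fun ε => W ε n m) 0)
      -- The periodicity of the variation in `m` passes to its derivative.
      (fun n m => ((hW n m).differentiable (by simp) 0).hasDerivAt) h0 (fun n => by
        congr 1
        funext ε
        have := hper ε n 0
        rwa [zero_add] at this)
    rw [h N] at h1
    · simpa using h1
    · intro n hn
      simp [fun ε m => hs ε n m hn, radialPart]

lemma mem_PRProfiles_iff {K : ℕ} (hK : 3 ≤ K) (δ : ℤ → ℤ → Bool) {ℓ : ℝ} (hℓ : 0 < ℓ)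
    {p : ℤ → E3} :
    p ∈ PRProfiles K δ ℓ ↔ p = discreteProfile ℓ
      (discreteCosh (Real.arcosh (1 + ℓ ^ 2 / (2 * Real.cos (Real.pi / K) ^ 2)))) := by
  constructor
  · rintro ⟨x, hx, h0, heven, hcrit, rfl⟩
    rw [isAreaCriticalMesh_rotMesh_iff hK hℓ hx] at hcrit
    rw [eq_discreteCosh_of_isStationary (pos_cos_pi_div hK) hℓ hx h0 heven hcrit]
  · rintro rfl
    refine ⟨discreteCosh _, discreteCosh_pos _, by simp [discreteCosh],
      fun n => by simp [discreteCosh], ?_, rfl⟩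
    exact (isAreaCriticalMesh_rotMesh_iff hK hℓ (discreteCosh_pos _) δ).2
      (isStationary_discreteCosh (pos_cos_pi_div hK) hℓ)

/-! ### Discrete Weierstrass representation with exponential Gauss map -/

/-- Both Gauss images lie on one ray with unit direction `u = C + S i`, and `E` is the geometric
mean of their moduli. Thus `g_q g_p = E² u²`, and the prefactor is a real multiple of the conjugate
of `u`, which leaves real and imaginary parts that can be read off. -/
lemma weierstrassEdge_radial {E h C S : ℝ} (hE : E ≠ 0) (hh : h ≠ 0) (hne : h - h⁻¹ ≠ 0)
    (hCS : C ^ 2 + S ^ 2 = 1) :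
    weierstrassEdge ((h - h⁻¹) ^ 2 / 2) (-(E * h⁻¹ * (C + S * Complex.I)))
      (-(E * h * (C + S * Complex.I))) =
      !₂[(h - h⁻¹) / 2 * (E - E⁻¹) * C, (h - h⁻¹) / 2 * (E - E⁻¹) * S, (h - h⁻¹) * (h + h⁻¹) / 2] := by
  have hCS' : (C : ℂ) ^ 2 + (S : ℂ) ^ 2 = 1 := by exact_mod_cast hCS
  have hI := Complex.I_sq
  have hE' : (E : ℂ) ≠ 0 := by exact_mod_cast hE
  have hh' : (h : ℂ) ≠ 0 := by exact_mod_cast hh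
  have hne' : (h : ℂ) - (h : ℂ)⁻¹ ≠ 0 := by exact_mod_cast hne
  have huu : ((C : ℂ) + S * Complex.I) * (C - S * Complex.I) = 1 := by
    linear_combination hCS' - (S : ℂ) ^ 2 * hI
  have hu : (C : ℂ) + S * Complex.I ≠ 0 := left_ne_zero_of_mul_eq_one huu
  have hubar : (C : ℂ) - S * Complex.I = ((C : ℂ) + S * Complex.I)⁻¹ :=
    (inv_eq_of_mul_eq_one_right huu).symm
  have hw : (((h - h⁻¹) ^ 2 / 2 : ℝ) : ℂ) / (-(E * h * (C + S * Complex.I)) -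
      -(E * (h : ℂ)⁻¹ * (C + S * Complex.I))) =
      -((h - (h : ℂ)⁻¹) / 2 * (E : ℂ)⁻¹) * (C - S * Complex.I) := by
    rw [hubar, show -(E * h * (C + S * Complex.I)) - -(E * (h : ℂ)⁻¹ * (C + S * Complex.I)) =
      -(E * (h - (h : ℂ)⁻¹) * (C + S * Complex.I)) by ring]
    push_cast
    generalize (h : ℂ) - (h : ℂ)⁻¹ = d at *
    field_simp
  rw [weierstrassEdge, Complex.ofReal_inv, hw]
  have hx : -((h - (h : ℂ)⁻¹) / 2 * (E : ℂ)⁻¹) * (C - S * Complex.I) *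
      (1 - -(E * h * (C + S * Complex.I)) * -(E * (h : ℂ)⁻¹ * (C + S * Complex.I))) =
      (((h - h⁻¹) / 2 * (E - E⁻¹) * C : ℝ) : ℂ) +
        (((h - h⁻¹) / 2 * (E + E⁻¹) * S : ℝ) : ℂ) * Complex.I := by
    push_cast
    have : (E : ℂ) * (E : ℂ)⁻¹ = 1 := mul_inv_cancel₀ hE'
    have h2 : (h : ℂ) * (h : ℂ)⁻¹ = 1 := mul_inv_cancel₀ hh'
    generalize (h : ℂ)⁻¹ = h' at *
    generalize (E : ℂ)⁻¹ = E' at *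
    rw [show -((h - h') / 2 * E') * (C - S * Complex.I) *
      (1 - -(E * h * (C + S * Complex.I)) * -(E * h' * (C + S * Complex.I))) =
      -((h - h') / 2) * (E' * (C - S * Complex.I) - (E * E') * E * (h * h') * (C + S * Complex.I) *
      ((C + S * Complex.I) * (C - S * Complex.I))) by ring, huu, this, h2]
    ring
  have hy : -((h - (h : ℂ)⁻¹) / 2 * (E : ℂ)⁻¹) * (C - S * Complex.I) *
      (Complex.I + Complex.I * -(E * h * (C + S * Complex.I)) *
        -(E * (h : ℂ)⁻¹ * (C + S * Complex.I))) =
      (((h - h⁻¹) / 2 * (E - E⁻¹) * S : ℝ) : ℂ) +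
        (-((h - h⁻¹) / 2 * (E + E⁻¹) * C : ℝ) : ℂ) * Complex.I := by
    push_cast
    have : (E : ℂ) * (E : ℂ)⁻¹ = 1 := mul_inv_cancel₀ hE'
    have h2 : (h : ℂ) * (h : ℂ)⁻¹ = 1 := mul_inv_cancel₀ hh'
    generalize (h : ℂ)⁻¹ = h' at *
    generalize (E : ℂ)⁻¹ = E' at *
    rw [show -((h - h') / 2 * E') * (C - S * Complex.I) *
      (Complex.I + Complex.I * -(E * h * (C + S * Complex.I)) * -(E * h' * (C + S * Complex.I))) =
      -((h - h') / 2) * Complex.I * (E' * (C - S * Complex.I) +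
      (E * E') * E * (h * h') * (C + S * Complex.I) *
      ((C + S * Complex.I) * (C - S * Complex.I))) by ring, huu, this, h2]
    linear_combination (-(h - h') / 2 * (E - E') * S) * hI
  have hz : -((h - (h : ℂ)⁻¹) / 2 * (E : ℂ)⁻¹) * (C - S * Complex.I) *
      (-(E * h * (C + S * Complex.I)) + -(E * (h : ℂ)⁻¹ * (C + S * Complex.I))) =
      (((h - h⁻¹) * (h + h⁻¹) / 2 : ℝ) : ℂ) := by
    rw [hubar]
    push_cast
    generalize (h : ℂ)⁻¹ = h' at *
    field_simp
    ring
  rw [hx, hy, hz]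
  apply ext_E3 <;> simp

/-- The two Gauss images have equal modulus `r` and are symmetric about the direction `C + S i`, so
their product is `r² (C + S i)²`. The third coordinate is purely imaginary before taking real parts,
hence the edge is horizontal. -/
lemma weierstrassEdge_angular {r c s C S : ℝ} (hr : r ≠ 0) (hs : s ≠ 0)
    (hcs : c ^ 2 + s ^ 2 = 1) (hCS : C ^ 2 + S ^ 2 = 1) :
    weierstrassEdge (-2 * s ^ 2) (-(r * (c - s * Complex.I) * (C + S * Complex.I)))
      (-(r * (c + s * Complex.I) * (C + S * Complex.I))) =
      !₂[-((r + r⁻¹) * s * S), (r + r⁻¹) * s * C, 0] := by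
  have hCS' : (C : ℂ) ^ 2 + (S : ℂ) ^ 2 = 1 := by exact_mod_cast hCS
  have hcs' : (c : ℂ) ^ 2 + (s : ℂ) ^ 2 = 1 := by exact_mod_cast hcs
  have hI := Complex.I_sq
  have hr' : (r : ℂ) ≠ 0 := by exact_mod_cast hr
  have hs' : (s : ℂ) ≠ 0 := by exact_mod_cast hs
  have huu : ((C : ℂ) + S * Complex.I) * (C - S * Complex.I) = 1 := by
    linear_combination hCS' - (S : ℂ) ^ 2 * hI
  have hpp : ((c : ℂ) + s * Complex.I) * (c - s * Complex.I) = 1 := by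
    linear_combination hcs' - (s : ℂ) ^ 2 * hI
  have hu : (C : ℂ) + S * Complex.I ≠ 0 := left_ne_zero_of_mul_eq_one huu
  have hrr : (r : ℂ) * (r : ℂ)⁻¹ = 1 := mul_inv_cancel₀ hr'
  have hw : ((-2 * s ^ 2 : ℝ) : ℂ) / (-(r * (c + s * Complex.I) * (C + S * Complex.I)) -
      -(r * (c - s * Complex.I) * (C + S * Complex.I))) =
      -(s * (r : ℂ)⁻¹) * Complex.I * (C - S * Complex.I) := by
    rw [show -(r * (c + s * Complex.I) * (C + S * Complex.I)) -
      -(r * (c - s * Complex.I) * (C + S * Complex.I)) =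
      -2 * r * s * Complex.I * (C + S * Complex.I) by ring, div_eq_iff (by simp [hr', hs', hu])]
    push_cast
    linear_combination -2 * s ^ 2 * (r * (r : ℂ)⁻¹) * Complex.I ^ 2 * huu -
      2 * s ^ 2 * (r * (r : ℂ)⁻¹) * hI + 2 * s ^ 2 * hrr
  rw [weierstrassEdge, hw]
  generalize hr'' : (r : ℂ)⁻¹ = r' at *
  have hx : -(s * r') * Complex.I * (C - S * Complex.I) *
      (1 - -(r * (c + s * Complex.I) * (C + S * Complex.I)) *
        -(r * (c - s * Complex.I) * (C + S * Complex.I))) =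
      ((-((r + r⁻¹) * s * S) : ℝ) : ℂ) + (((r - r⁻¹) * s * C : ℝ) : ℂ) * Complex.I := by
    push_cast
    rw [hr'', show -(s * r') * Complex.I * (C - S * Complex.I) *
      (1 - -(r * (c + s * Complex.I) * (C + S * Complex.I)) *
        -(r * (c - s * Complex.I) * (C + S * Complex.I))) = -s * Complex.I *
      (r' * (C - S * Complex.I) - (r * r') * r * ((c + s * Complex.I) * (c - s * Complex.I)) *
      (C + S * Complex.I) * ((C + S * Complex.I) * (C - S * Complex.I))) by ring, huu, hpp, hrr]
    linear_combination s * S * (r + r') * hI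
  have hy : -(s * r') * Complex.I * (C - S * Complex.I) *
      (Complex.I + Complex.I * -(r * (c + s * Complex.I) * (C + S * Complex.I)) *
        -(r * (c - s * Complex.I) * (C + S * Complex.I))) =
      (((r + r⁻¹) * s * C : ℝ) : ℂ) + (((r - r⁻¹) * s * S : ℝ) : ℂ) * Complex.I := by
    push_cast
    rw [hr'', show -(s * r') * Complex.I * (C - S * Complex.I) *
      (Complex.I + Complex.I * -(r * (c + s * Complex.I) * (C + S * Complex.I)) *
        -(r * (c - s * Complex.I) * (C + S * Complex.I))) = -s * Complex.I ^ 2 *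
      (r' * (C - S * Complex.I) + (r * r') * r * ((c + s * Complex.I) * (c - s * Complex.I)) *
      (C + S * Complex.I) * ((C + S * Complex.I) * (C - S * Complex.I))) by ring, huu, hpp, hrr, hI]
    ring
  have hz : -(s * r') * Complex.I * (C - S * Complex.I) *
      (-(r * (c + s * Complex.I) * (C + S * Complex.I)) +
        -(r * (c - s * Complex.I) * (C + S * Complex.I))) =
      ((2 * s * c : ℝ) : ℂ) * Complex.I := by
    push_cast
    rw [show -(s * r') * Complex.I * (C - S * Complex.I) *
      (-(r * (c + s * Complex.I) * (C + S * Complex.I)) +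
        -(r * (c - s * Complex.I) * (C + S * Complex.I))) =
      2 * s * c * (r * r') * Complex.I * ((C + S * Complex.I) * (C - S * Complex.I)) by ring,
      huu, hrr]
    ring
  rw [hx, hy, hz]
  apply ext_E3 <;> simp

/-- The Gauss map of the discrete catenoid in polar form. -/
lemma bpGauss_eq (c₁ c₂ n m : ℝ) :
    (-1 : ℂ) * Complex.exp ((c₁ : ℂ) * (n : ℂ) + Complex.I * (c₂ : ℂ) * (m : ℂ)) =
      -((Real.exp (c₁ * n) : ℂ) *
        ((Real.cos (c₂ * m) : ℂ) + (Real.sin (c₂ * m) : ℂ) * Complex.I)) := by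
  rw [Complex.exp_add, show Complex.I * (c₂ : ℂ) * (m : ℂ) = ((c₂ * m : ℝ) : ℂ) * Complex.I by
    push_cast; ring, Complex.exp_mul_I]
  push_cast
  ring

lemma exp_half_sub_inv (a : ℝ) : Real.exp (a / 2) - (Real.exp (a / 2))⁻¹ = 2 * Real.sinh (a / 2) := by
  rw [← Real.exp_neg, Real.sinh_eq]; ring

lemma bp_radial_edge {c₁ : ℝ} (h₁ : c₁ ≠ 0) (c₂ : ℝ) (n m : ℝ) :
    weierstrassEdge (-(-2) * Real.sinh (c₁ / 2) ^ 2)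
      ((-1 : ℂ) * Complex.exp ((c₁ : ℂ) * (n : ℂ) + Complex.I * (c₂ : ℂ) * (m : ℂ)))
      ((-1 : ℂ) * Complex.exp ((c₁ : ℂ) * ((n + 1 : ℝ) : ℂ) + Complex.I * (c₂ : ℂ) * (m : ℂ))) =
      rotPt (Real.cosh ((n + 1) * c₁) - Real.cosh (n * c₁)) (c₂ * m) (Real.sinh c₁) := by
  have hne : Real.exp (c₁ / 2) - (Real.exp (c₁ / 2))⁻¹ ≠ 0 := by
    rw [exp_half_sub_inv]; simpa using h₁
  -- The modulus is taken at the midpoint of the edge, so that the endpoints differ from it by the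
  -- factors `exp (± c₁ / 2)`.
  have h := weierstrassEdge_radial (E := Real.exp (c₁ * n + c₁ / 2)) (h := Real.exp (c₁ / 2))
    (C := Real.cos (c₂ * m)) (S := Real.sin (c₂ * m)) (Real.exp_ne_zero _) (Real.exp_ne_zero _) hne
    (by rw [add_comm]; exact Real.sin_sq_add_cos_sq _)
  rw [bpGauss_eq, bpGauss_eq]
  have e1 : Real.exp (c₁ * n) = Real.exp (c₁ * n + c₁ / 2) * (Real.exp (c₁ / 2))⁻¹ := by
    rw [← Real.exp_neg, ← Real.exp_add]; ring_nf
  have e2 : Real.exp (c₁ * (n + 1)) = Real.exp (c₁ * n + c₁ / 2) * Real.exp (c₁ / 2) := by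
    rw [← Real.exp_add]; ring_nf
  have e3 : -(-2) * Real.sinh (c₁ / 2) ^ 2 = (Real.exp (c₁ / 2) - (Real.exp (c₁ / 2))⁻¹) ^ 2 / 2 := by
    rw [exp_half_sub_inv]; ring
  have e4 : (Real.exp (c₁ / 2) - (Real.exp (c₁ / 2))⁻¹) / 2 *
      (Real.exp (c₁ * n + c₁ / 2) - (Real.exp (c₁ * n + c₁ / 2))⁻¹) =
      Real.cosh ((n + 1) * c₁) - Real.cosh (n * c₁) := by
    rw [exp_half_sub_inv, ← Real.exp_neg, show (n + 1) * c₁ = (c₁ * n + c₁ / 2) + c₁ / 2 by ring,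
      show n * c₁ = (c₁ * n + c₁ / 2) - c₁ / 2 by ring, Real.cosh_add, Real.cosh_sub,
      Real.sinh_eq (c₁ * n + c₁ / 2)]
    ring
  have e5 : (Real.exp (c₁ / 2) - (Real.exp (c₁ / 2))⁻¹) *
      (Real.exp (c₁ / 2) + (Real.exp (c₁ / 2))⁻¹) / 2 = Real.sinh c₁ := by
    rw [exp_half_sub_inv, ← Real.exp_neg, show Real.sinh c₁ = Real.sinh (2 * (c₁ / 2)) by ring_nf,
      Real.sinh_two_mul, Real.cosh_eq]
    ring
  rw [e1, e2, e3]
  rw [e4, e5] at h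
  push_cast at h ⊢
  exact h

lemma bp_angular_edge (c₁ : ℝ) {c₂ : ℝ} (h₂ : Real.sin (c₂ / 2) ≠ 0) (n m : ℝ) :
    weierstrassEdge (-2 * Real.sin (c₂ / 2) ^ 2)
      ((-1 : ℂ) * Complex.exp ((c₁ : ℂ) * (n : ℂ) + Complex.I * (c₂ : ℂ) * (m : ℂ)))
      ((-1 : ℂ) * Complex.exp ((c₁ : ℂ) * (n : ℂ) + Complex.I * (c₂ : ℂ) * ((m + 1 : ℝ) : ℂ))) =
      rotPt (Real.cosh (n * c₁)) (c₂ * (m + 1)) 0 - rotPt (Real.cosh (n * c₁)) (c₂ * m) 0 := by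
  have h := weierstrassEdge_angular (r := Real.exp (c₁ * n)) (c := Real.cos (c₂ / 2))
    (C := Real.cos (c₂ * m + c₂ / 2)) (S := Real.sin (c₂ * m + c₂ / 2)) (Real.exp_ne_zero _) h₂
    (by rw [add_comm]; exact Real.sin_sq_add_cos_sq _)
    (by rw [add_comm]; exact Real.sin_sq_add_cos_sq _)
  have hcosh : Real.exp (c₁ * n) + (Real.exp (c₁ * n))⁻¹ = 2 * Real.cosh (n * c₁) := by
    rw [← Real.exp_neg, Real.cosh_eq]; ring_nf
  have em : c₂ * m = (c₂ * m + c₂ / 2) - c₂ / 2 := by ring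
  have ep : c₂ * (m + 1) = (c₂ * m + c₂ / 2) + c₂ / 2 := by ring
  have hI := Complex.I_sq
  rw [bpGauss_eq, bpGauss_eq]
  rw [hcosh] at h
  have hcm := Real.cos_sub (c₂ * m + c₂ / 2) (c₂ / 2)
  have hsm := Real.sin_sub (c₂ * m + c₂ / 2) (c₂ / 2)
  have hcp := Real.cos_add (c₂ * m + c₂ / 2) (c₂ / 2)
  have hsp := Real.sin_add (c₂ * m + c₂ / 2) (c₂ / 2)
  rw [← em] at hcm hsm
  rw [← ep] at hcp hsp
  rw [rotPt, rotPt, hcm, hsm, hcp, hsp]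
  generalize c₂ * m + c₂ / 2 = μ at *
  refine Eq.trans ?_ (h.trans ?_)
  · congr 1 <;> rw [mul_assoc] <;> congr 2 <;> push_cast
    · linear_combination Complex.sin (c₂ / 2) * Complex.sin μ * hI
    · linear_combination -Complex.sin (c₂ / 2) * Complex.sin μ * hI
  · apply ext_E3 <;> simp <;> ring

/-- With `A = exp (c₁ / 2)` and `B = exp (i c₂ / 2)` the four values are `-G` times `1`, `A²`, `A²
B²`, `B²`; the factor `G` cancels and the claim is an identity in `A` and `B`. -/
lemma bp_crossRatio {c₁ c₂ : ℝ} (h₁ : c₁ ≠ 0) (h₂ : Real.sin (c₂ / 2) ≠ 0) (n m : ℂ) :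
    crossRatio ((-1 : ℂ) * Complex.exp ((c₁ : ℂ) * n + Complex.I * (c₂ : ℂ) * m))
      ((-1 : ℂ) * Complex.exp ((c₁ : ℂ) * (n + 1) + Complex.I * (c₂ : ℂ) * m))
      ((-1 : ℂ) * Complex.exp ((c₁ : ℂ) * (n + 1) + Complex.I * (c₂ : ℂ) * (m + 1)))
      ((-1 : ℂ) * Complex.exp ((c₁ : ℂ) * n + Complex.I * (c₂ : ℂ) * (m + 1))) =
      ((-(-2) * Real.sinh (c₁ / 2) ^ 2 : ℝ) : ℂ) / ((-2 * Real.sin (c₂ / 2) ^ 2 : ℝ) : ℂ) := by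
  obtain ⟨A, hA⟩ : ∃ A, A = Complex.exp ((c₁ / 2 : ℝ) : ℂ) := ⟨_, rfl⟩
  obtain ⟨B, hB⟩ : ∃ B, B = Complex.exp ((c₂ / 2 : ℝ) * Complex.I) := ⟨_, rfl⟩
  obtain ⟨G, hG⟩ : ∃ G, G = Complex.exp ((c₁ : ℂ) * n + Complex.I * (c₂ : ℂ) * m) := ⟨_, rfl⟩
  have hA0 : A ≠ 0 := hA ▸ Complex.exp_ne_zero _
  have hB0 : B ≠ 0 := hB ▸ Complex.exp_ne_zero _
  have hG0 : G ≠ 0 := hG ▸ Complex.exp_ne_zero _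
  have hsinh : ((Real.sinh (c₁ / 2) : ℝ) : ℂ) = (A - A⁻¹) / 2 := by
    rw [hA, ← Complex.exp_neg, Complex.ofReal_sinh, Complex.sinh]
  have hsin : ((Real.sin (c₂ / 2) : ℝ) : ℂ) = (B⁻¹ - B) * Complex.I / 2 := by
    rw [hB, ← Complex.exp_neg, Complex.ofReal_sin, Complex.sin, neg_mul]
  have hsinh0 : ((Real.sinh (c₁ / 2) : ℝ) : ℂ) ≠ 0 := by
    exact_mod_cast (by simpa using h₁ : Real.sinh (c₁ / 2) ≠ 0)
  have hsin0 : ((Real.sin (c₂ / 2) : ℝ) : ℂ) ≠ 0 := by exact_mod_cast h₂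
  have e1 : Complex.exp ((c₁ : ℂ) * (n + 1) + Complex.I * (c₂ : ℂ) * m) = G * A ^ 2 := by
    rw [hG, hA, ← Complex.exp_nat_mul, ← Complex.exp_add]; push_cast; ring_nf
  have e2 : Complex.exp ((c₁ : ℂ) * n + Complex.I * (c₂ : ℂ) * (m + 1)) = G * B ^ 2 := by
    rw [hG, hB, ← Complex.exp_nat_mul, ← Complex.exp_add]; push_cast; ring_nf
  have e3 : Complex.exp ((c₁ : ℂ) * (n + 1) + Complex.I * (c₂ : ℂ) * (m + 1)) =
      G * A ^ 2 * B ^ 2 := by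
    rw [hG, hA, hB, ← Complex.exp_nat_mul, ← Complex.exp_nat_mul, ← Complex.exp_add,
      ← Complex.exp_add]
    push_cast; ring_nf
  rw [crossRatio, e1, e2, e3, ← hG]
  push_cast at hsinh hsin hsinh0 hsin0 ⊢
  have hB1 : B ^ 2 - 1 ≠ 0 := by
    intro h
    apply hsin0
    rw [hsin, show B⁻¹ - B = -(B ^ 2 - 1) * B⁻¹ by field_simp; ring, h]
    simp
  rw [hsinh, hsin, show (-1 * (G * A ^ 2) - -1 * (G * A ^ 2 * B ^ 2)) * (-1 * (G * B ^ 2) - -1 * G) =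
    -(G ^ 2 * A ^ 2 * (B ^ 2 - 1) ^ 2) by ring,
    show (-2 : ℂ) * ((B⁻¹ - B) * Complex.I / 2) ^ 2 = (B ^ 2 - 1) ^ 2 / (2 * B ^ 2) by
      rw [div_pow, mul_pow, Complex.I_sq]; field_simp; ring]
  field_simp
  ring

lemma isWeierstrassNet_bp {c₁ c₂ : ℝ} (h₁ : c₁ ≠ 0) (h₂ : Real.sin (c₂ / 2) ≠ 0) :
    IsWeierstrassNet
      (fun n m => (-1 : ℂ) * Complex.exp ((c₁ : ℂ) * (n : ℂ) + Complex.I * (c₂ : ℂ) * (m : ℂ)))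
      (fun _ => -(-2) * Real.sinh (c₁ / 2) ^ 2) (fun _ => (-2) * Real.sin (c₂ / 2) ^ 2)
      (fun n m => rotPt (Real.cosh (n * c₁)) (c₂ * m) (n * Real.sinh c₁)) := by
  refine ⟨fun n m => ?_, fun n m => ?_, fun n m => ?_⟩
  · have := bp_crossRatio h₁ h₂ n m
    push_cast at this ⊢
    exact this
  · have := bp_radial_edge h₁ c₂ n m
    push_cast at this ⊢
    rw [this]
    apply ext_E3 <;> simp [rotPt] <;> ring
  · have := bp_angular_edge c₁ h₂ n m
    push_cast at this ⊢
    rw [this]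
    apply ext_E3 <;> simp [rotPt]

/-- Along `m = 0` the edges in the first direction and the value at the origin determine the net.
The cross ratios and the other edges matter only for existence. -/
lemma mem_BPProfiles_iff {c₁ c₂ : ℝ} (h₁ : c₁ ≠ 0) (h₂ : Real.sin (c₂ / 2) ≠ 0) {p : ℤ → E3} :
    p ∈ BPProfiles c₁ c₂ ↔ p = discreteProfile (Real.sinh c₁) (discreteCosh c₁) := by
  constructor
  · rintro ⟨X, ⟨-, hX, -⟩, h0, rfl⟩
    have key : ∀ n : ℤ, X (n + 1) 0 - discreteProfile (Real.sinh c₁) (discreteCosh c₁) (n + 1) =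
        X n 0 - discreteProfile (Real.sinh c₁) (discreteCosh c₁) n := by
      intro n
      rw [sub_eq_sub_iff_sub_eq_sub, hX n 0]
      have := bp_radial_edge h₁ c₂ n 0
      push_cast at this ⊢
      rw [this]
      apply ext_E3 <;> simp [rotPt, discreteProfile, discreteCosh]
      ring
    funext n
    rw [← sub_eq_zero]
    induction n using Int.induction_on with
    | zero => rw [h0]; apply ext_E3 <;> simp [discreteProfile, discreteCosh]
    | succ n ih => rw [key, ih]
    | pred n ih => rw [← key, sub_add_cancel, ih]
  · rintro rfl
    refine ⟨_, isWeierstrassNet_bp h₁ h₂, ?_, ?_⟩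
    · apply ext_E3 <;> simp [rotPt]
    · funext n
      apply ext_E3 <;> simp [rotPt, discreteProfile, discreteCosh]

/-! ### Criteria for conjugate and circular nets -/

lemma not_linearIndependent_of_parallel {ι : Type*} {v : ι → E3} {i j : ι} (hij : i ≠ j) {e : E3}
    {a b : ℝ} (hi : v i = a • e) (hj : v j = b • e) : ¬ LinearIndependent ℝ v := by
  intro h
  have h2 : LinearIndependent ℝ ![v i, v j] := by
    have := h.comp ![i, j] (by
      intro k l hkl
      fin_cases k <;> fin_cases l <;> simp_all)
    convert this using 1
    funext k
    fin_cases k <;> rfl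
  have h3 := LinearIndependent.pair_iff.1 h2 b (-a) (by rw [hi, hj]; module)
  exact h.ne_zero i (by rw [hi, neg_eq_zero.1 h3.2, zero_smul])

/-- Reduces circularity to scalar identities in the plane through `C` spanned by a unit vector `e`
and an orthogonal, not necessarily unit, vector `w`. -/
lemma exists_circle {x x₁ v v₁ e w C : E3} {a b a₁ b₁ p q p₁ q₁ : ℝ} (he : ‖e‖ ^ 2 = 1)
    (hw : 0 < ‖w‖ ^ 2) (hew : inner ℝ e w = 0) (hx : x - C = a • e + b • w)
    (hx₁ : x₁ - C = a₁ • e + b₁ • w) (hv : v = p • e + q • w) (hv₁ : v₁ = p₁ • e + q₁ • w)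
    (hr : a₁ ^ 2 + b₁ ^ 2 * ‖w‖ ^ 2 = a ^ 2 + b ^ 2 * ‖w‖ ^ 2)
    (hpos : 0 < a ^ 2 + b ^ 2 * ‖w‖ ^ 2) (ho : p * a + q * b * ‖w‖ ^ 2 = 0)
    (ho₁ : p₁ * a₁ + q₁ * b₁ * ‖w‖ ^ 2 = 0) :
    ∃ (c : E3) (r : ℝ) (P : Submodule ℝ E3), 0 < r ∧ Module.finrank ℝ P = 2 ∧
      (x - c ∈ P ∧ ‖x - c‖ = r ∧ v ∈ P ∧ inner ℝ v (x - c) = 0) ∧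
      (x₁ - c ∈ P ∧ ‖x₁ - c‖ = r ∧ v₁ ∈ P ∧ inner ℝ v₁ (x₁ - c) = 0) := by
  have hwe : inner ℝ w e = 0 := by rw [real_inner_comm, hew]
  have hin : ∀ s t s' t' : ℝ, inner ℝ (s • e + t • w) (s' • e + t' • w) =
      s * s' + t * t' * ‖w‖ ^ 2 := by
    intro s t s' t'
    simp only [inner_add_left, inner_add_right, real_inner_smul_left, real_inner_smul_right, hew,
      hwe, real_inner_self_eq_norm_sq, he]
    ring
  have hmem : ∀ s t : ℝ, s • e + t • w ∈ Submodule.span ℝ (Set.range ![e, w]) := by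
    intro s t
    exact Submodule.add_mem _ (Submodule.smul_mem _ _ (Submodule.subset_span ⟨0, rfl⟩))
      (Submodule.smul_mem _ _ (Submodule.subset_span ⟨1, rfl⟩))
  have hnorm : ∀ s t : ℝ, ‖s • e + t • w‖ = √(s ^ 2 + t ^ 2 * ‖w‖ ^ 2) := by
    intro s t
    rw [← Real.sqrt_sq (norm_nonneg _), ← real_inner_self_eq_norm_sq, hin]
    congr 1; ring
  refine ⟨C, √(a ^ 2 + b ^ 2 * ‖w‖ ^ 2), Submodule.span ℝ (Set.range ![e, w]),
    Real.sqrt_pos.2 hpos, ?_, ?_, ?_⟩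
  · rw [finrank_span_eq_card, Fintype.card_fin]
    rw [LinearIndependent.pair_iff]
    intro s t hst
    have h1 := hin s t 1 0
    have h2 := hin s t 0 1
    rw [hst, inner_zero_left] at h1 h2
    exact ⟨by linarith, by simpa [hw.ne'] using h2.symm⟩
  · rw [hx, hv]
    exact ⟨hmem _ _, hnorm _ _, hmem _ _, by rw [hin, ho]⟩
  · rw [hx₁, hv₁]
    exact ⟨hmem _ _, by rw [hnorm, hr], hmem _ _, by rw [hin, ho₁]⟩

/-! ### Semi-discrete catenoids with discrete profile -/

lemma sdDeriv_rotPt_angle (f z : ℤ → ℝ) (k : ℤ) (t : ℝ) :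
    sdDeriv (fun k t => rotPt (f k) t (z k)) k t =
      f k • (!₂[-Real.sin t, Real.cos t, 0] : E3) := by
  rw [sdDeriv, (hasDerivAt_rotPt_angle _ _ _).deriv]
  apply ext_E3 <;> simp

lemma isConjugate_rotPt_angle (f z : ℤ → ℝ) : IsConjugate (fun k t => rotPt (f k) t (z k)) := by
  refine ⟨fun k t => (hasDerivAt_rotPt_angle _ _ _).differentiableAt, fun k t => ?_⟩
  have h : sdDeriv (sdDiff fun k t => rotPt (f k) t (z k)) k t =
      (f (k + 1) - f k) • (!₂[-Real.sin t, Real.cos t, 0] : E3) := by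
    rw [sub_smul, ← sdDeriv_rotPt_angle f z k t, ← sdDeriv_rotPt_angle f z (k + 1) t]
    exact ((hasDerivAt_rotPt_angle (f (k + 1)) t (z (k + 1))).differentiableAt.hasDerivAt.sub
      (hasDerivAt_rotPt_angle (f k) t (z k)).differentiableAt.hasDerivAt).deriv
  exact not_linearIndependent_of_parallel (i := 0) (j := 2) (by decide)
    (sdDeriv_rotPt_angle f z k t) h

lemma norm_sq_rotPt_sub (r r₁ t z z₁ : ℝ) :
    ‖rotPt r₁ t z₁ - rotPt r t z‖ ^ 2 = (r₁ - r) ^ 2 + (z₁ - z) ^ 2 := by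
  rw [norm_sq_E3]
  simp [rotPt]
  linear_combination (r₁ - r) ^ 2 * Real.sin_sq_add_cos_sq t

lemma isCircular_rotPt_angle (f z : ℤ → ℝ) (hz : ∀ k, z (k + 1) ≠ z k) :
    IsCircular (fun k t => rotPt (f k) t (z k)) := by
  refine ⟨fun k t => (hasDerivAt_rotPt_angle _ _ _).differentiableAt, fun k t => ?_⟩
  have hpos : 0 < ‖rotPt (f (k + 1)) t (z (k + 1)) - rotPt (f k) t (z k)‖ ^ 2 := by
    rw [norm_sq_rotPt_sub]
    have := sub_ne_zero.2 (hz k)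
    positivity
  -- The edge is a diameter: both tangents are parallel to `e`, which is orthogonal to the edge.
  refine exists_circle (e := !₂[-Real.sin t, Real.cos t, 0])
    (w := rotPt (f (k + 1)) t (z (k + 1)) - rotPt (f k) t (z k))
    (C := (1 / 2 : ℝ) • (rotPt (f (k + 1)) t (z (k + 1)) + rotPt (f k) t (z k)))
    (a := 0) (b := -1 / 2) (a₁ := 0) (b₁ := 1 / 2) (p := f k) (q := 0) (p₁ := f (k + 1)) (q₁ := 0)
    ?_ hpos ?_ (by module) (by module) ?_ ?_ (by ring) (by linarith) (by ring) (by ring)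
  · rw [norm_sq_E3]; simp only [Matrix.cons_val]; linarith [Real.sin_sq_add_cos_sq t]
  · rw [inner_E3]; simp [rotPt]; ring
  · rw [sdDeriv_rotPt_angle]; simp
  · rw [sdDeriv_rotPt_angle]; simp

/-- The normalized dual vertex has radius `1 / f k` and height `u k`. Evenness gives equal squares
of the heights at `±1`, and positive increments exclude equal heights; hence these are opposite, the
neck is on the equator and `ρ = 1`. Writing `f k = cosh s` and `f k * u k = sinh s`, the increment
condition becomes the subtraction formula for `sinh`. -/
lemma eq_discreteCosh_of_dual {f u : ℤ → ℝ} {h ρ : ℝ} (hf : ∀ k, 0 < f k) (h0 : f 0 = 1)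
    (heven : ∀ k, f (-k) = f k) (hsphere : ∀ k, 1 + (f k * u k) ^ 2 = ρ * f k ^ 2)
    (hstep : ∀ k, f (k + 1) * f k * (u (k + 1) - u k) = h) (hh : 0 < h) :
    f = discreteCosh (Real.arsinh h) := by
  have hu0 : u 0 = 0 := by
    have s1 := hsphere 1
    have s2 := hsphere (-1)
    have t1 := hstep 0
    have t2 := hstep (-1)
    have hf1 := hf 1
    rw [heven] at s2 t2
    rw [zero_add, h0] at t1
    rw [neg_add_cancel, h0] at t2
    have e1 : u 1 - u (-1) ≠ 0 := by
      intro e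
      have : f 1 * (u 1 - u (-1)) = 2 * h := by linarith
      rw [e] at this; linarith
    have e2 : f 1 ^ 2 * (u 1 - u (-1)) * (u 1 + u (-1)) = 0 := by linear_combination s1 - s2
    have e3 : u 1 + u (-1) = 0 := (mul_eq_zero.1 e2).resolve_left (by positivity)
    have e4 : f 1 * (2 * u 0) = 0 := by linear_combination t2 - t1 + f 1 * e3
    have := (mul_eq_zero.1 e4).resolve_left hf1.ne'
    linarith
  have hρ : ρ = 1 := by have := hsphere 0; rw [hu0, h0] at this; linarith
  have hcosh : ∀ k, Real.cosh (Real.arsinh (f k * u k)) = f k := by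
    intro k
    rw [Real.cosh_arsinh, hsphere, hρ, one_mul, Real.sqrt_sq (hf k).le]
  have hs : ∀ k, Real.arsinh (f (k + 1) * u (k + 1)) - Real.arsinh (f k * u k) =
      Real.arsinh h := by
    intro k
    rw [← Real.arsinh_sinh (_ - _), Real.sinh_sub, hcosh, hcosh, Real.sinh_arsinh,
      Real.sinh_arsinh, ← hstep k]
    ring_nf
  have key : ∀ k : ℤ, Real.arsinh (f k * u k) = k * Real.arsinh h := by
    intro k
    induction k using Int.induction_on with
    | zero => simp [hu0]
    | succ n ih => have := hs n; push_cast at ih ⊢; linarith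
    | pred n ih => have := hs (-n - 1); rw [sub_add_cancel] at this; push_cast at ih ⊢; linarith
  funext k
  rw [discreteCosh, ← key, hcosh]

lemma eq_const_of_hasDerivAt_zero {F : ℝ → ℝ} (h : ∀ t, HasDerivAt F 0 t) (s t : ℝ) :
    F s = F t :=
  is_const_of_deriv_eq_zero (fun t => (h t).differentiableAt) (fun t => (h t).deriv) s t

lemma eq_discreteCosh_of_isSemiDiscreteMinimal {f : ℤ → ℝ} {h : ℝ} (hh : 0 < h)
    (hf : ∀ k, 0 < f k) (h0 : f 0 = 1) (heven : ∀ k, f (-k) = f k)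
    (hmin : IsSemiDiscreteMinimal (fun k t => rotPt (f k) t (h * k))) :
    f = discreteCosh (Real.arsinh h) := by
  obtain ⟨ν, σ, τ, ⟨-, hν, hσ, hτ, hdiff, hderiv⟩, xs, ⟨-, hconj, -, hxd, hxΔ⟩, c, R, hR, hS⟩ := hmin
  have hnD : ∀ k t, f k ^ 2 = τ t * ν k t ^ 2 := by
    intro k t
    rw [← hderiv, sdDeriv_rotPt_angle f (fun k => h * k) k t, norm_sq_E3]
    simp
    linear_combination -f k ^ 2 * Real.sin_sq_add_cos_sq t
  have hnΔ : ∀ k t, (f (k + 1) - f k) ^ 2 + h ^ 2 = σ k * ν k t * ν (k + 1) t := by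
    intro k t
    rw [← hdiff, sdDiff, norm_sq_rotPt_sub]
    push_cast; ring
  have hνν : ∀ k t, τ t * (ν k t * ν (k + 1) t) = f k * f (k + 1) := by
    intro k t
    have h1 := hnD k t
    have h2 := hnD (k + 1) t
    have := hν k t; have := hν (k + 1) t; have := hτ t; have := hf k; have := hf (k + 1)
    rw [← sq_eq_sq₀ (by positivity) (by positivity), mul_pow, mul_pow, mul_pow, h1, h2]
    ring
  -- Edge lengths and radii do not depend on `t`, hence neither does `τ`.
  obtain ⟨T, hT⟩ : ∃ T, ∀ t, τ t = T := by
    refine ⟨τ 0, fun t => ?_⟩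
    have e : ∀ t, τ t = σ 0 * (f 0 * f (0 + 1)) / ((f (0 + 1) - f 0) ^ 2 + h ^ 2) := by
      intro t
      rw [eq_div_iff (by positivity), ← hνν 0 t, hnΔ 0 t]; ring
    rw [e, e]
  simp only [hT] at hτ hnD hνν
  have hTpos : 0 < T := hτ 0
  have hd : ∀ k t, HasDerivAt (xs k) (!₂[T / f k * Real.sin t, -(T / f k * Real.cos t), 0]) t := by
    intro k t
    have e := hxd k t
    rw [sdDeriv_rotPt_angle f (fun k => h * k) k t] at e
    refine (hconj.1 k t).hasDerivAt.congr_deriv (e.trans ?_)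
    have h1 := hnD k t
    have h2 := hν k t
    have h3 := hf k
    have h4 : 1 / ν k t ^ 2 * f k = T / f k := by
      rw [div_mul_eq_mul_div, one_mul, div_eq_div_iff (by positivity) (by positivity)]
      linarith
    rw [smul_smul, neg_mul, h4]
    apply ext_E3 <;> simp
  have hA : ∀ k s t, xs k s 0 + T / f k * Real.cos s = xs k t 0 + T / f k * Real.cos t := by
    intro k
    refine eq_const_of_hasDerivAt_zero fun t => ?_
    refine ((hasDerivAt_coord (hd k t) 0).add
      ((Real.hasDerivAt_cos t).const_mul (T / f k))).congr_deriv ?_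
    simp
  have hB : ∀ k s t, xs k s 1 + T / f k * Real.sin s = xs k t 1 + T / f k * Real.sin t := by
    intro k
    refine eq_const_of_hasDerivAt_zero fun t => ?_
    refine ((hasDerivAt_coord (hd k t) 1).add
      ((Real.hasDerivAt_sin t).const_mul (T / f k))).congr_deriv ?_
    simp
  have hZ : ∀ k s t, xs k s 2 = xs k t 2 := by
    intro k
    exact eq_const_of_hasDerivAt_zero fun t => by simpa using hasDerivAt_coord (hd k t) 2
  have hS2 : ∀ k t, (xs k t 0 - c 0) ^ 2 + (xs k t 1 - c 1) ^ 2 + (xs k t 2 - c 2) ^ 2 = R ^ 2 := by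
    intro k t
    rw [← hS k t, norm_sq_E3]; rfl
  -- Each dual curve is a horizontal circle of radius `T / f k`. Four of its points suffice to show
  -- that its centre lies on the vertical line through the centre of the sphere.
  have hsphere : ∀ k, (T / f k) ^ 2 + (xs k 0 2 - c 2) ^ 2 = R ^ 2 := by
    intro k
    have hpos : 0 < T / f k := div_pos hTpos (hf k)
    have a1 := hA k Real.pi 0
    have a2 := hA k (Real.pi / 2) 0
    have a3 := hA k (-(Real.pi / 2)) 0
    have b1 := hB k Real.pi 0
    have b2 := hB k (Real.pi / 2) 0
    have b3 := hB k (-(Real.pi / 2)) 0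
    have s0 := hS2 k 0
    have s1 := hS2 k Real.pi
    have s2 := hS2 k (Real.pi / 2)
    have s3 := hS2 k (-(Real.pi / 2))
    rw [hZ k _ 0] at s1 s2 s3
    simp only [Real.cos_pi, Real.cos_zero, Real.cos_pi_div_two, Real.cos_neg, Real.sin_neg,
      Real.sin_pi, Real.sin_zero, Real.sin_pi_div_two] at a1 a2 a3 b1 b2 b3
    rw [show xs k Real.pi 0 = xs k 0 0 + 2 * (T / f k) by linarith,
      show xs k Real.pi 1 = xs k 0 1 by linarith] at s1
    rw [show xs k (Real.pi / 2) 0 = xs k 0 0 + T / f k by linarith,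
      show xs k (Real.pi / 2) 1 = xs k 0 1 - T / f k by linarith] at s2
    rw [show xs k (-(Real.pi / 2)) 0 = xs k 0 0 + T / f k by linarith,
      show xs k (-(Real.pi / 2)) 1 = xs k 0 1 + T / f k by linarith] at s3
    generalize T / f k = y at *
    have e1 : y * (xs k 0 0 - c 0 + y) = 0 := by linear_combination (s1 - s0) / 4
    have e2 : y * (xs k 0 1 - c 1) = 0 := by linear_combination (s3 - s2) / 4
    have e3 := (mul_eq_zero.1 e1).resolve_left hpos.ne'
    have e4 := (mul_eq_zero.1 e2).resolve_left hpos.ne'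
    linear_combination s0 - e3 * (xs k 0 0 - c 0 - y) - e4 * (xs k 0 1 - c 1)
  have hstep : ∀ k, f (k + 1) * f k * (xs (k + 1) 0 2 - xs k 0 2) = T * h := by
    intro k
    have e := congrArg (fun v : E3 => v 2) (hxΔ k 0)
    simp only [sdDiff, PiLp.sub_apply, PiLp.smul_apply, smul_eq_mul, rotPt, Matrix.cons_val] at e
    have h1 := hνν k 0
    have h2 := hν k 0
    have h3 := hν (k + 1) 0
    rw [e, mul_comm (f (k + 1)), ← h1]
    push_cast
    field_simp
    ring
  refine eq_discreteCosh_of_dual (u := fun k => (xs k 0 2 - c 2) / T) (ρ := R ^ 2 / T ^ 2) hf h0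
    heven (fun k => ?_) (fun k => ?_) hh
  · have h1 := hsphere k
    have h2 := (hf k).ne'
    field_simp at h1 ⊢
    linarith
  · have h1 := hstep k
    field_simp
    linarith

lemma isSemiDiscreteMinimal_discreteCosh {h : ℝ} (hh : 0 < h) :
    IsSemiDiscreteMinimal
      (fun k t => rotPt (discreteCosh (Real.arsinh h) k) t (h * k)) := by
  obtain ⟨f, hf⟩ : ∃ f, f = discreteCosh (Real.arsinh h) := ⟨_, rfl⟩
  have hpos : ∀ k, 0 < f k := fun k => hf ▸ discreteCosh_pos _ k
  rw [← hf]
  -- With `ν = f` and `τ = 1` the dual is inscribed in the unit sphere, with radii `1 / cosh` and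
  -- heights `tanh`. The radius is entered with a minus sign because `∂x* = -ν⁻² ∂x`.
  refine ⟨fun k _ => f k, fun k => ((f (k + 1) - f k) ^ 2 + h ^ 2) / (f k * f (k + 1)), fun _ => 1,
    ⟨isCircular_rotPt_angle f (fun k => h * k) fun k => ?_, fun k _ => hpos k, fun k => ?_,
      fun _ => one_pos, fun k t => ?_, fun k t => ?_⟩,
    fun k t => rotPt (-(1 / f k)) t (Real.tanh (k * Real.arsinh h)),
    ⟨isConjugate_rotPt_angle f (fun k => h * k), isConjugate_rotPt_angle _ _, fun k _ => hpos k,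
      fun k t => ?_, fun k t => ?_⟩, 0, 1, one_pos, fun k t => ?_⟩
  · push_cast; intro e; linarith
  · have := hpos k; have := hpos (k + 1); positivity
  · have := hpos k; have := hpos (k + 1)
    rw [sdDiff, norm_sq_rotPt_sub]
    push_cast
    field_simp
    ring
  · rw [sdDeriv_rotPt_angle f (fun k => h * k), norm_sq_E3]
    simp
    linear_combination f k ^ 2 * Real.sin_sq_add_cos_sq t
  · have := hpos k
    rw [sdDeriv_rotPt_angle f (fun k => h * k), sdDeriv_rotPt_angle, smul_smul]
    congr 1
    field_simp
  · have h1 := hpos k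
    have h2 := hpos (k + 1)
    have e1 : Real.cosh (k * Real.arsinh h) = f k := by rw [hf]; rfl
    have e2 : Real.cosh ((k + 1) * Real.arsinh h) = f (k + 1) := by
      rw [hf, discreteCosh]; push_cast; rfl
    -- The subtraction formula for `sinh`; after division by `f k * f (k + 1)` it gives the height
    -- step of the dual.
    have e3 : h = Real.sinh ((k + 1) * Real.arsinh h) * f k -
        f (k + 1) * Real.sinh (k * Real.arsinh h) := by
      rw [← e1, ← e2, ← Real.sinh_sub, show ((k : ℝ) + 1) * Real.arsinh h - k * Real.arsinh h =
        Real.arsinh h by ring, Real.sinh_arsinh]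
    apply ext_E3 <;> simp [sdDiff, rotPt]
    · field_simp; ring
    · field_simp; ring
    · rw [Real.tanh_eq_sinh_div_cosh, Real.tanh_eq_sinh_div_cosh, e1, e2]
      field_simp
      linarith
  · have h1 := hpos k
    have e1 : Real.cosh (k * Real.arsinh h) = f k := by rw [hf]; rfl
    have e2 := Real.cosh_sq (k * Real.arsinh h)
    rw [sub_zero]
    refine (sq_eq_sq₀ (norm_nonneg _) zero_le_one).1 ?_
    rw [norm_sq_E3]
    simp [rotPt]
    rw [Real.tanh_eq_sinh_div_cosh, e1]
    rw [e1] at e2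
    field_simp
    linear_combination Real.sin_sq_add_cos_sq t - e2

lemma mem_MWpdrsProfiles_iff {h : ℝ} (hh : 0 < h) {p : ℤ → E3} :
    p ∈ MWpdrsProfiles h ↔ p = discreteProfile h (discreteCosh (Real.arsinh h)) := by
  constructor
  · rintro ⟨f, hf, h0, heven, hmin, rfl⟩
    rw [eq_discreteCosh_of_isSemiDiscreteMinimal hh hf h0 heven hmin]
  · rintro rfl
    exact ⟨discreteCosh _, discreteCosh_pos _, by simp [discreteCosh],
      fun n => by simp [discreteCosh], isSemiDiscreteMinimal_discreteCosh hh, rfl⟩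

/-! ### Semi-discrete catenoids with smooth profile -/

/-- The combinations `(f ± g) exp (∓ b t)` are constant, so no uniqueness theorem for differential
equations is needed. -/
lemma eq_cosh_of_hasDerivAt {b : ℝ} {f g : ℝ → ℝ} (hf : ∀ t, HasDerivAt f (b * g t) t)
    (hg : ∀ t, HasDerivAt g (b * f t) t) (hf0 : f 0 = 1) (hg0 : g 0 = 0) :
    f = fun t => Real.cosh (b * t) := by
  have hb : ∀ a t : ℝ, HasDerivAt (fun t => Real.exp (a * t)) (Real.exp (a * t) * a) t := by
    intro a t
    simpa using ((hasDerivAt_id t).const_mul a).exp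
  have h1 : ∀ t, (f t + g t) * Real.exp (-b * t) = 1 := by
    intro t
    rw [eq_const_of_hasDerivAt_zero (F := fun t => (f t + g t) * Real.exp (-b * t))
      (fun t => (((hf t).add (hg t)).mul (hb (-b) t)).congr_deriv
        (by simp only [Pi.add_apply]; ring)) t 0]
    simp [hf0, hg0]
  have h2 : ∀ t, (f t - g t) * Real.exp (b * t) = 1 := by
    intro t
    rw [eq_const_of_hasDerivAt_zero (F := fun t => (f t - g t) * Real.exp (b * t))
      (fun t => (((hf t).sub (hg t)).mul (hb b t)).congr_deriv
        (by simp only [Pi.sub_apply]; ring)) t 0]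
    simp [hf0, hg0]
  funext t
  have e1 := h1 t
  have e2 := h2 t
  have e3 : Real.exp (-b * t) * Real.exp (b * t) = 1 := by
    rw [← Real.exp_add]; simp
  rw [Real.cosh_eq, ← neg_mul]
  linear_combination (1 / 2 : ℝ) * Real.exp (b * t) * e1 + (1 / 2 : ℝ) * Real.exp (-b * t) * e2 -
    f t * e3

/-- Differentiating the sphere equation gives `f' = -f G`. The neck condition then forces `G 0 = 0`
and `ρ = 1`, and the pair `f`, `-f G` solves the linear system of `cosh` and `sinh`. -/
lemma eq_cosh_of_dual {f G : ℝ → ℝ} {ρ : ℝ} (hf : ∀ t, 0 < f t) (hd : Differentiable ℝ f)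
    (h0 : f 0 = 1) (h0' : deriv f 0 = 0) (hG : ∀ t, HasDerivAt G (-(1 / f t ^ 2)) t)
    (hsphere : ∀ t, (1 / f t) ^ 2 + G t ^ 2 = ρ) : f = Real.cosh := by
  have hfd : ∀ t, deriv f t = -(f t * G t) := by
    intro t
    have h1 := ((((hd t).hasDerivAt.inv (hf t).ne').pow 2).add ((hG t).pow 2))
    have h2 : HasDerivAt (fun t => (1 / f t) ^ 2 + G t ^ 2) 0 t := by
      simp only [hsphere]; exact hasDerivAt_const _ _
    have h3 := h1.unique (h2.congr_of_eventuallyEq (.of_forall fun t => by simp))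
    have h4 := hf t
    simp only [Pi.inv_apply] at h3
    field_simp at h3
    norm_num at h3
    field_simp at h3
    linarith
  have hG0 : G 0 = 0 := by have := hfd 0; rw [h0', h0] at this; linarith
  have hρ : ρ = 1 := by rw [← hsphere 0, hG0, h0]; norm_num
  have h1 := eq_cosh_of_hasDerivAt (b := 1) (f := f) (g := fun t => -(f t * G t))
    (fun t => (hd t).hasDerivAt.congr_deriv (by rw [hfd, one_mul]))
    (fun t => by
      have h2 := hf t
      have h3 := hsphere t
      refine (((hd t).hasDerivAt.mul (hG t)).neg).congr_deriv ?_
      rw [hfd]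
      rw [hρ] at h3
      field_simp at h3 ⊢
      linarith) h0 (by simp [hG0])
  rw [h1]
  simp

lemma sdDeriv_rotPt_profile {f z : ℝ → ℝ} (φ : ℤ → ℝ) (hf : Differentiable ℝ f)
    (hz : Differentiable ℝ z) (k : ℤ) (t : ℝ) :
    sdDeriv (fun k t => rotPt (f t) (φ k) (z t)) k t = rotPt (deriv f t) (φ k) (deriv z t) :=
  (hasDerivAt_rotPt_profile _ (hf t).hasDerivAt (hz t).hasDerivAt).deriv

lemma isConjugate_rotPt_profile {f z : ℝ → ℝ} (φ : ℤ → ℝ) (hf : Differentiable ℝ f)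
    (hz : Differentiable ℝ z) : IsConjugate (fun k t => rotPt (f t) (φ k) (z t)) := by
  have hd := fun k t => hasDerivAt_rotPt_profile (φ k) (hf t).hasDerivAt (hz t).hasDerivAt
  refine ⟨fun k t => (hd k t).differentiableAt, fun k t => ?_⟩
  have h : sdDeriv (sdDiff fun k t => rotPt (f t) (φ k) (z t)) k t =
      deriv f t • (rotPt 1 (φ (k + 1)) 0 - rotPt 1 (φ k) 0) := by
    refine ((hd (k + 1) t).sub (hd k t)).deriv.trans ?_
    apply ext_E3 <;> simp [rotPt] <;> ring
  refine not_linearIndependent_of_parallel (i := 1) (j := 2)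
    (e := rotPt 1 (φ (k + 1)) 0 - rotPt 1 (φ k) 0) (a := f t) (by decide) ?_ h
  apply ext_E3 <;> simp [sdDiff, rotPt] <;> ring

lemma isCircular_rotPt_profile {f : ℝ → ℝ} {α : ℝ} (hα : Real.sin (α / 2) ≠ 0)
    (hpos : ∀ t, 0 < f t) (hf : Differentiable ℝ f) :
    IsCircular (fun k t => rotPt (f t) (α * k) t) := by
  have hd := fun (k : ℤ) t => hasDerivAt_rotPt_profile (α * k) (hf t).hasDerivAt (hasDerivAt_id t)
  refine ⟨fun k t => (hd k t).differentiableAt, fun k t => ?_⟩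
  have e0 : α * k = (α * k + α / 2) - α / 2 := by ring
  have e1 : α * (k + 1 : ℤ) = (α * k + α / 2) + α / 2 := by push_cast; ring
  have hv : sdDeriv (fun k t => rotPt (f t) (α * k) t) k t =
    rotPt (deriv f t) (α * k) 1 := (hd k t).deriv
  have hv₁ : sdDeriv (fun k t => rotPt (f t) (α * k) t) (k + 1) t =
    rotPt (deriv f t) (α * (k + 1 : ℤ)) 1 := (hd (k + 1) t).deriv
  rw [hv, hv₁]
  simp only [e1]
  rw [e0]
  generalize α * k + α / 2 = ψ
  set s := Real.sin (α / 2) with hs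
  set c := Real.cos (α / 2) with hc
  have hw : ‖rotPt (deriv f t * c) ψ 1‖ ^ 2 = (deriv f t * c) ^ 2 + 1 := by
    rw [norm_sq_E3]
    simp [rotPt]
    linear_combination (deriv f t * c) ^ 2 * Real.sin_sq_add_cos_sq ψ
  have hfp := hpos t
  -- `w` is the mean of the two tangents. The centre lies on the line through the midpoint of the
  -- edge in direction `w`, and orthogonality of radius and tangent determines its offset `β`.
  obtain ⟨β, hβ⟩ : ∃ β, β * ((deriv f t * c) ^ 2 + 1) = f t * deriv f t * s ^ 2 :=
    ⟨f t * deriv f t * s ^ 2 / ((deriv f t * c) ^ 2 + 1), div_mul_cancel₀ _ (by positivity)⟩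
  refine exists_circle (e := !₂[-Real.sin ψ, Real.cos ψ, 0]) (w := rotPt (deriv f t * c) ψ 1)
    (C := rotPt (f t * c) ψ t + β • rotPt (deriv f t * c) ψ 1)
    (a := -(f t * s)) (b := -β) (a₁ := f t * s) (b₁ := -β) (p := -(deriv f t * s)) (q := 1)
    (p₁ := deriv f t * s) (q₁ := 1) ?_ ?_ ?_ ?_ ?_ ?_ ?_ ?_ ?_ ?_ ?_
  · rw [norm_sq_E3]; simp only [Matrix.cons_val]; linarith [Real.sin_sq_add_cos_sq ψ]
  · rw [hw]; positivity
  · rw [inner_E3]; simp [rotPt]; ring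
  · apply ext_E3 <;> simp [rotPt, Real.cos_sub, Real.sin_sub, ← hs, ← hc] <;> ring
  · apply ext_E3 <;> simp [rotPt, Real.cos_add, Real.sin_add, ← hs, ← hc] <;> ring
  · apply ext_E3 <;> simp [rotPt, Real.cos_sub, Real.sin_sub, ← hs, ← hc] <;> ring
  · apply ext_E3 <;> simp [rotPt, Real.cos_add, Real.sin_add, ← hs, ← hc] <;> ring
  · ring
  · rw [hw, neg_sq]
    have : s ≠ 0 := hα
    positivity
  · rw [hw]; linear_combination -hβ
  · rw [hw]; linear_combination -hβ

lemma one_sub_cos_pos {α : ℝ} (hα : Real.sin (α / 2) ≠ 0) : 0 < 1 - Real.cos α := by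
  have h := Real.cos_two_mul (α / 2)
  rw [mul_div_cancel₀ α two_ne_zero] at h
  have h2 := Real.sin_sq_add_cos_sq (α / 2)
  have : 0 < Real.sin (α / 2) ^ 2 := by positivity
  linarith

lemma norm_sq_rotPt_sub_rotPt (r φ ψ z : ℝ) :
    ‖rotPt r φ z - rotPt r ψ z‖ ^ 2 = 2 * (1 - Real.cos (φ - ψ)) * r ^ 2 := by
  rw [norm_sq_E3, Real.cos_sub]
  simp [rotPt]
  linear_combination r ^ 2 * (Real.sin_sq_add_cos_sq φ + Real.sin_sq_add_cos_sq ψ)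

lemma eq_cosh_of_isSemiDiscreteMinimal {f : ℝ → ℝ} {α : ℝ} (hα : Real.sin (α / 2) ≠ 0)
    (hf : ∀ t, 0 < f t) (h0 : f 0 = 1) (h0' : deriv f 0 = 0)
    (hmin : IsSemiDiscreteMinimal (fun k t => rotPt (f t) (α * k) t)) : f = Real.cosh := by
  obtain ⟨ν, σ, τ, ⟨hcirc, hν, hσ, hτ, hdiff, hderiv⟩, xs, ⟨-, hconj, -, hxd, hxΔ⟩, c, R, hR, hS⟩ :=
    hmin
  have hκ := one_sub_cos_pos hα
  have hfd : Differentiable ℝ f := by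
    intro t
    have := (hasDerivAt_coord (hcirc.1 0 t).hasDerivAt 0).differentiableAt
    simpa [rotPt] using this
  have hD : ∀ k t, sdDeriv (fun k t => rotPt (f t) (α * k) t) k t =
      rotPt (deriv f t) (α * k) 1 := by
    intro k t
    simpa using sdDeriv_rotPt_profile (fun k => α * k) hfd differentiable_id k t
  have hnD : ∀ k t, deriv f t ^ 2 + 1 = τ t * ν k t ^ 2 := by
    intro k t
    rw [← hderiv, hD, norm_sq_E3]
    simp [rotPt]
    linear_combination -deriv f t ^ 2 * Real.sin_sq_add_cos_sq (α * k)
  -- The speed is the same on all meridians, so `ν` does not depend on `k`; the edge lengths then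
  -- make it proportional to the radius.
  have hν1 : ∀ k t, ν k t = ν 0 t := by
    intro k t
    have h1 := (hnD k t).symm.trans (hnD 0 t)
    exact (sq_eq_sq₀ (hν k t).le (hν 0 t).le).1 (mul_left_cancel₀ (hτ t).ne' h1)
  obtain ⟨M, hM, hνM⟩ : ∃ M, 0 < M ∧ ∀ t, ν 0 t ^ 2 = M * f t ^ 2 := by
    refine ⟨2 * (1 - Real.cos α) / σ 0, div_pos (by linarith) (hσ 0), fun t => ?_⟩
    have h1 := hdiff 0 t
    rw [sdDiff, norm_sq_rotPt_sub_rotPt, hν1 (0 + 1)] at h1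
    have h2 : α * ((0 + 1 : ℤ) : ℝ) - α * ((0 : ℤ) : ℝ) = α := by push_cast; ring
    rw [h2] at h1
    have := hσ 0
    field_simp
    linarith
  have hd : ∀ t, HasDerivAt (xs 0) (-(1 / (M * f t ^ 2)) • rotPt (deriv f t) 0 1) t := by
    intro t
    have h1 := hxd 0 t
    rw [hD, hνM] at h1
    refine (hconj.1 0 t).hasDerivAt.congr_deriv (h1.trans ?_)
    simp
  have hΔ : ∀ k t, xs (k + 1) t - xs k t =
      (1 / (M * f t)) • (rotPt 1 (α * (k + 1 : ℤ)) 0 - rotPt 1 (α * k) 0) := by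
    intro k t
    have h1 := hxΔ k t
    rw [sdDiff, hν1 k, hν1 (k + 1), ← sq, hνM] at h1
    have := hf t
    rw [h1]
    apply ext_E3 <;> simp [sdDiff, rotPt] <;> field_simp
  have hS2 : ∀ k t, (xs k t 0 - c 0) ^ 2 + (xs k t 1 - c 1) ^ 2 + (xs k t 2 - c 2) ^ 2 = R ^ 2 := by
    intro k t
    rw [← hS k t, norm_sq_E3]; rfl
  -- Three consecutive dual vertices lie on the sphere. The second difference of their sphere
  -- equations eliminates the second coordinate and leaves the first.
  have hp : ∀ t, xs 0 t 0 - c 0 = 1 / (M * f t) := by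
    intro t
    have d1 := hΔ 0 t
    have d2 := hΔ (-1) t
    have s0 := hS2 0 t
    have s1 := hS2 1 t
    have s2 := hS2 (-1) t
    have hm : 0 < 1 / (M * f t) := by have := hf t; positivity
    generalize 1 / (M * f t) = m at *
    have a0 := congrArg (fun v : E3 => v 0) d1
    have a1 := congrArg (fun v : E3 => v 1) d1
    have a2 := congrArg (fun v : E3 => v 2) d1
    have b0 := congrArg (fun v : E3 => v 0) d2
    have b1 := congrArg (fun v : E3 => v 1) d2
    have b2 := congrArg (fun v : E3 => v 2) d2
    simp [rotPt] at a0 a1 a2 b0 b1 b2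
    rw [show xs 1 t 0 = xs 0 t 0 + m * (Real.cos α - 1) by linarith,
      show xs 1 t 1 = xs 0 t 1 + m * Real.sin α by linarith,
      show xs 1 t 2 = xs 0 t 2 by linarith] at s1
    rw [show xs (-1) t 0 = xs 0 t 0 - m * (1 - Real.cos α) by linarith,
      show xs (-1) t 1 = xs 0 t 1 - m * Real.sin α by linarith,
      show xs (-1) t 2 = xs 0 t 2 by linarith] at s2
    have e1 : m * (1 - Real.cos α) * (xs 0 t 0 - c 0 - m) = 0 := by
      linear_combination -(s1 + s2 - 2 * s0) / 4 + m ^ 2 / 2 * Real.sin_sq_add_cos_sq α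
    have e2 := (mul_eq_zero.1 e1).resolve_left (by positivity)
    linarith
  -- The second coordinate need not be centred, since for `α = π` the sphere equations leave it
  -- free; its constancy suffices, as it only changes the radius of the sphere.
  have hq : ∀ t, xs 0 t 1 = xs 0 0 1 := by
    intro t
    refine eq_const_of_hasDerivAt_zero (F := fun t => xs 0 t 1) (fun t => ?_) t 0
    refine (hasDerivAt_coord (hd t) 1).congr_deriv ?_
    simp [rotPt]
  refine eq_cosh_of_dual (G := fun t => M * (xs 0 t 2 - c 2))
    (ρ := M ^ 2 * (R ^ 2 - (xs 0 0 1 - c 1) ^ 2)) hf hfd h0 h0' (fun t => ?_) (fun t => ?_)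
  · refine (((hasDerivAt_coord (hd t) 2).sub_const (c 2)).const_mul M).congr_deriv ?_
    have := hf t
    simp [rotPt]
    field_simp
  · have h1 := hS2 0 t
    rw [hp, hq] at h1
    have := hf t
    field_simp at h1 ⊢
    linear_combination h1

lemma isSemiDiscreteMinimal_cosh {α : ℝ} (hα : Real.sin (α / 2) ≠ 0) :
    IsSemiDiscreteMinimal (fun k t => rotPt (Real.cosh t) (α * k) t) := by
  have hκ := one_sub_cos_pos hα
  have hc := Real.cosh_pos
  have hdi : ∀ t, HasDerivAt (fun t => 1 / Real.cosh t) (-(Real.sinh t / Real.cosh t ^ 2)) t := by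
    intro t
    exact (((Real.hasDerivAt_cosh t).inv (hc t).ne').congr_of_eventuallyEq
      (.of_forall fun t => by simp)).congr_deriv (neg_div _ _)
  have hdt : ∀ t, HasDerivAt (fun t => -Real.tanh t) (-(1 / Real.cosh t ^ 2)) t := by
    intro t
    have h1 := ((Real.hasDerivAt_sinh t).div (Real.hasDerivAt_cosh t) (hc t).ne').neg
    refine (h1.congr_of_eventuallyEq (.of_forall fun t => ?_)).congr_deriv ?_
    · simp [Real.tanh_eq_sinh_div_cosh]
    · rw [← sq, ← sq, Real.cosh_sq]; ring
  have hD : ∀ k t, sdDeriv (fun k t => rotPt (Real.cosh t) (α * k) t) k t =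
      rotPt (Real.sinh t) (α * k) 1 := by
    intro k t
    simpa using sdDeriv_rotPt_profile (fun k => α * k) Real.differentiable_cosh differentiable_id k t
  -- The dual is again given by points of the unit sphere, of radius `1 / cosh t` and height `-tanh
  -- t`, with `ν = cosh` and `τ = 1`.
  refine ⟨fun _ t => Real.cosh t, fun k => 2 * (1 - Real.cos α), fun _ => 1,
    ⟨isCircular_rotPt_profile hα hc Real.differentiable_cosh, fun _ t => hc t,
      fun _ => by linarith, fun _ => one_pos, fun k t => ?_, fun k t => ?_⟩,
    fun k t => rotPt (1 / Real.cosh t) (α * k) (-Real.tanh t),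
    ⟨isConjugate_rotPt_profile _ Real.differentiable_cosh differentiable_id,
      isConjugate_rotPt_profile _ (fun t => (hdi t).differentiableAt)
        (fun t => (hdt t).differentiableAt), fun _ t => hc t, fun k t => ?_, fun k t => ?_⟩,
    0, 1, one_pos, fun k t => ?_⟩
  · rw [sdDiff, norm_sq_rotPt_sub_rotPt, show α * ((k + 1 : ℤ) : ℝ) - α * k = α by push_cast; ring]
    ring
  · rw [hD, norm_sq_E3, Real.cosh_sq]
    simp [rotPt]
    linear_combination Real.sinh t ^ 2 * Real.sin_sq_add_cos_sq (α * k)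
  · rw [hD, sdDeriv_rotPt_profile _ (fun t => (hdi t).differentiableAt)
        (fun t => (hdt t).differentiableAt), (hdi t).deriv, (hdt t).deriv]
    apply ext_E3 <;> simp [rotPt] <;> ring
  · have := hc t
    apply ext_E3 <;> simp [sdDiff, rotPt] <;> field_simp
  · have := hc t
    have e := Real.cosh_sq t
    rw [sub_zero]
    refine (sq_eq_sq₀ (norm_nonneg _) zero_le_one).1 ?_
    rw [norm_sq_E3]
    simp [rotPt]
    rw [Real.tanh_eq_sinh_div_cosh]
    field_simp
    linear_combination Real.sin_sq_add_cos_sq (α * k) - e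

lemma mem_MWpsrdProfiles_iff {α : ℝ} (hα : Real.sin (α / 2) ≠ 0) {p : ℝ → E3} :
    p ∈ MWpsrdProfiles α ↔ p = graphProfile Real.cosh := by
  constructor
  · rintro ⟨f, hf, h0, h0', hmin, rfl⟩
    rw [eq_cosh_of_isSemiDiscreteMinimal hα hf h0 h0' hmin]
  · rintro rfl
    exact ⟨Real.cosh, Real.cosh_pos, Real.cosh_zero, by simp, isSemiDiscreteMinimal_cosh hα, rfl⟩

/-! ### Surfaces foliated by regular polygons -/

/-- Differentiation under the integral sign; a bound for the derivative on the compact set `[-1, 1]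
× [a, b]` serves as the dominating constant. -/
lemma hasDerivAt_intervalIntegral {F F' : ℝ → ℝ → ℝ} (hF : Continuous (Function.uncurry F))
    (hF' : Continuous (Function.uncurry F'))
    (hd : ∀ ε t, HasDerivAt (fun ε => F ε t) (F' ε t) ε) (a b : ℝ) :
    HasDerivAt (fun ε => ∫ t in a..b, F ε t) (∫ t in a..b, F' 0 t) 0 := by
  obtain ⟨C, hC⟩ := ((isCompact_Icc (a := (-1 : ℝ)) (b := 1)).prod
    (isCompact_uIcc (a := a) (b := b))).exists_bound_of_continuousOn hF'.continuousOn
  refine (intervalIntegral.hasDerivAt_integral_of_dominated_loc_of_deriv_le (F := F) (F' := F')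
    (bound := fun _ => C) (s := Set.Icc (-1) 1) (Icc_mem_nhds (by norm_num) (by norm_num))
    (.of_forall fun ε => ?_) ?_ ?_ (.of_forall fun t ht ε hε => ?_) (by simp)
    (.of_forall fun t _ ε _ => hd ε t)).2
  · exact (hF.comp (by fun_prop : Continuous fun t : ℝ => (ε, t))).aestronglyMeasurable
  · exact (hF.comp (by fun_prop : Continuous fun t : ℝ => ((0 : ℝ), t))).intervalIntegrable _ _
  · exact (hF'.comp (by fun_prop : Continuous fun t : ℝ => ((0 : ℝ), t))).aestronglyMeasurable
  · exact hC (ε, t) ⟨hε, Set.uIoc_subset_uIcc ht⟩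

/-- The horizontal segment has length `2 sin (π/K) g`, and the velocity component orthogonal to it
consists of `cos (π/K) g'` and the vertical `1`. The density therefore does not depend on `u`. -/
lemma ruledPieceArea_eq {K : ℕ} (hK : 3 ≤ K) {r : ℝ} (hr : 0 < r) {g : ℝ → ℝ}
    (hg : Differentiable ℝ g) (hpos : ∀ t ∈ Set.Icc (-r) r, 0 < g t) :
    ruledPieceArea K r g = 2 * Real.sin (Real.pi / K) *
      ∫ t in (-r)..r, g t * √(1 + Real.cos (Real.pi / K) ^ 2 * deriv g t ^ 2) := by
  have hs := pos_sin_pi_div hK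
  have hsc := Real.sin_sq_add_cos_sq (Real.pi / K)
  have hθ : 2 * Real.pi / K = 2 * (Real.pi / K) := by ring
  have key : ∀ u : ℝ, ∀ t ∈ Set.uIcc (-r) r,
      parallelogramArea
        (deriv (fun u' => (1 - u') • rotPt (g t) 0 t + u' • rotPt (g t) (2 * Real.pi / K) t) u)
        (deriv (fun t' => (1 - u) • rotPt (g t') 0 t' + u • rotPt (g t') (2 * Real.pi / K) t') t) =
      2 * Real.sin (Real.pi / K) *
        (g t * √(1 + Real.cos (Real.pi / K) ^ 2 * deriv g t ^ 2)) := by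
    intro u t ht
    rw [Set.uIcc_of_le (by linarith)] at ht
    have hgt := hpos t ht
    have hd1 : HasDerivAt
        (fun u' : ℝ => (1 - u') • rotPt (g t) 0 t + u' • rotPt (g t) (2 * Real.pi / K) t)
        (rotPt (g t) (2 * Real.pi / K) t - rotPt (g t) 0 t) u := by
      refine ((((hasDerivAt_id u).const_sub 1).smul_const (rotPt (g t) 0 t)).add
        ((hasDerivAt_id u).smul_const (rotPt (g t) (2 * Real.pi / K) t))).congr_deriv ?_
      module
    have hd2 : ∀ φ, HasDerivAt (fun t => rotPt (g t) φ t) (rotPt (deriv g t) φ 1) t := fun φ =>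
      hasDerivAt_rotPt_profile φ (hg t).hasDerivAt (hasDerivAt_id t)
    have hd3 := ((hd2 0).const_smul (1 - u)).add ((hd2 (2 * Real.pi / K)).const_smul u)
    rw [hd1.deriv]
    erw [hd3.deriv]
    rw [parallelogramArea, norm_sq_E3, norm_sq_E3, inner_E3, hθ]
    simp only [rotPt, PiLp.sub_apply, PiLp.add_apply, PiLp.smul_apply, smul_eq_mul, Matrix.cons_val,
      Real.cos_zero, Real.sin_zero, Real.cos_two_mul, Real.sin_two_mul]
    generalize Real.sin (Real.pi / K) = s at *
    generalize Real.cos (Real.pi / K) = c at *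
    have e : (2 * s * (g t * √(1 + c ^ 2 * deriv g t ^ 2))) ^ 2 =
        4 * s ^ 2 * g t ^ 2 * (1 + c ^ 2 * deriv g t ^ 2) := by
      rw [mul_pow, mul_pow _ (√_), Real.sq_sqrt (by positivity)]; ring
    rw [← Real.sqrt_sq (show 0 ≤ 2 * s * (g t * √(1 + c ^ 2 * deriv g t ^ 2)) by positivity), e]
    congr 1
    have hc : c ^ 2 = 1 - s ^ 2 := by linarith
    ring_nf
    rw [show c ^ 4 = (c ^ 2) ^ 2 by ring, hc]
    ring
  rw [ruledPieceArea, patchArea]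
  rw [intervalIntegral.integral_congr fun u _ => intervalIntegral.integral_congr (key u)]
  simp

lemma hasDerivAt_snd {Y : ℝ × ℝ → ℝ} (hY : Differentiable ℝ Y) (ε t : ℝ) :
    HasDerivAt (fun t => Y (ε, t)) (fderiv ℝ Y (ε, t) (0, 1)) t :=
  (hY (ε, t)).hasFDerivAt.comp_hasDerivAt t ((hasDerivAt_const t ε).prodMk (hasDerivAt_id t))

lemma hasDerivAt_fst {Y : ℝ × ℝ → ℝ} (hY : Differentiable ℝ Y) (ε t : ℝ) :
    HasDerivAt (fun ε => Y (ε, t)) (fderiv ℝ Y (ε, t) (1, 0)) ε :=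
  (hY (ε, t)).hasFDerivAt.comp_hasDerivAt ε ((hasDerivAt_id ε).prodMk (hasDerivAt_const ε t))

lemma contDiff_fderiv_apply {Y : ℝ × ℝ → ℝ} (hY : ContDiff ℝ ∞ Y) (v : ℝ × ℝ) :
    ContDiff ℝ ∞ (fun q => fderiv ℝ Y q v) :=
  (hY.fderiv_right (by simp)).clm_apply contDiff_const

lemma fderiv_fderiv_apply_comm {Y : ℝ × ℝ → ℝ} (hY : ContDiff ℝ ∞ Y) (q v w : ℝ × ℝ) :
    fderiv ℝ (fun q => fderiv ℝ Y q v) q w = fderiv ℝ (fun q => fderiv ℝ Y q w) q v := by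
  have hd : DifferentiableAt ℝ (fderiv ℝ Y) q :=
    (hY.fderiv_right (m := ∞) (by simp)).differentiable (by simp) q
  have h1 : ∀ v, fderiv ℝ (fun q => fderiv ℝ Y q v) q = (fderiv ℝ (fderiv ℝ Y) q).flip v := by
    intro v
    rw [fderiv_clm_apply hd (differentiableAt_const _)]
    simp
  rw [h1, h1, ContinuousLinearMap.flip_apply, ContinuousLinearMap.flip_apply]
  exact (hY.contDiffAt.isSymmSndFDerivAt (by
    rw [minSmoothness_of_isRCLikeNormedField]; exact WithTop.coe_le_coe.2 (le_top : (2 : ℕ∞) ≤ ⊤))).eq _ _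

/-- The Euler-Lagrange operator of `∫ x √(1 + c² x'²)`. -/
noncomputable def eulerLagrange (c : ℝ) (x : ℝ → ℝ) (t : ℝ) : ℝ :=
  √(1 + c ^ 2 * deriv x t ^ 2) -
    deriv (fun t => c ^ 2 * x t * deriv x t / √(1 + c ^ 2 * deriv x t ^ 2)) t

lemma contDiff_deriv_infty {x : ℝ → ℝ} (hx : ContDiff ℝ ∞ x) : ContDiff ℝ ∞ (deriv x) :=
  (contDiff_infty_iff_deriv.1 hx).2

lemma contDiff_speed (c : ℝ) {x : ℝ → ℝ} (hx : ContDiff ℝ ∞ x) :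
    ContDiff ℝ ∞ (fun t => √(1 + c ^ 2 * deriv x t ^ 2)) :=
  (contDiff_const.add (contDiff_const.mul ((contDiff_deriv_infty hx).pow 2))).sqrt
    fun t => by positivity

lemma contDiff_momentum (c : ℝ) {x : ℝ → ℝ} (hx : ContDiff ℝ ∞ x) :
    ContDiff ℝ ∞ (fun t => c ^ 2 * x t * deriv x t / √(1 + c ^ 2 * deriv x t ^ 2)) :=
  ((contDiff_const.mul hx).mul (contDiff_deriv_infty hx)).div (contDiff_speed c hx)
    fun t => by positivity

lemma contDiff_eulerLagrange (c : ℝ) {x : ℝ → ℝ} (hx : ContDiff ℝ ∞ x) :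
    ContDiff ℝ ∞ (eulerLagrange c x) :=
  (contDiff_speed c hx).sub (contDiff_deriv_infty (contDiff_momentum c hx))

/-- The first variation, integrated by parts; smoothness of `y` in both variables permits exchanging
the derivatives in `ε` and `t`. -/
lemma hasDerivAt_ruledPieceArea {K : ℕ} (hK : 3 ≤ K) {r : ℝ} (hr : 0 < r) {x : ℝ → ℝ}
    (hx : ∀ t, 0 < x t) {y : ℝ → ℝ → ℝ} (hy : ContDiff ℝ ∞ (fun q : ℝ × ℝ => y q.1 q.2))
    (hy0 : ∀ t, y 0 t = x t) (hyr : ∀ ε, y ε r = x r ∧ y ε (-r) = x (-r)) :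
    HasDerivAt (fun ε => ruledPieceArea K r (y ε))
      (2 * Real.sin (Real.pi / K) * ∫ t in (-r)..r,
        deriv (fun ε => y ε t) 0 * eulerLagrange (Real.cos (Real.pi / K)) x t) 0 := by
  set c := Real.cos (Real.pi / K)
  set Y : ℝ × ℝ → ℝ := fun q => y q.1 q.2 with hYdef
  have hYd : Differentiable ℝ Y := hy.differentiable (by simp)
  have hxs : ContDiff ℝ ∞ x := by
    have h := hy.comp ((contDiff_const (c := (0 : ℝ))).prodMk contDiff_id)
    have e : Y ∘ (fun t : ℝ => ((0 : ℝ), id t)) = x := funext hy0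
    rwa [e] at h
  have hYt := contDiff_fderiv_apply hy (0, 1)
  have hYe := contDiff_fderiv_apply hy (1, 0)
  have hYte := contDiff_fderiv_apply hYt (1, 0)
  have hYtd : Differentiable ℝ (fun q => fderiv ℝ Y q (0, 1)) := hYt.differentiable (by simp)
  have hYed : Differentiable ℝ (fun q => fderiv ℝ Y q (1, 0)) := hYe.differentiable (by simp)
  have hdt : ∀ ε t, deriv (y ε) t = fderiv ℝ Y (ε, t) (0, 1) :=
    fun ε t => (hasDerivAt_snd hYd ε t).deriv
  have hdx : ∀ t, fderiv ℝ Y (0, t) (0, 1) = deriv x t := by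
    intro t
    rw [← hdt, show y 0 = x from funext hy0]
  have hW : ContDiff ℝ ∞ (fun q => √(1 + c ^ 2 * fderiv ℝ Y q (0, 1) ^ 2)) :=
    (contDiff_const.add (contDiff_const.mul (hYt.pow 2))).sqrt fun q => by positivity
  have hWpos : ∀ q, √(1 + c ^ 2 * fderiv ℝ Y q (0, 1) ^ 2) ≠ 0 := fun q => by positivity
  have hQ : ContDiff ℝ ∞ (fun q => c ^ 2 * Y q * fderiv ℝ Y q (0, 1) /
      √(1 + c ^ 2 * fderiv ℝ Y q (0, 1) ^ 2)) :=
    ((contDiff_const.mul hy).mul hYt).div hW hWpos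
  have hF' := ((hYe.mul hW).add (hQ.mul hYte)).continuous
  have hint := hasDerivAt_intervalIntegral
    (F := fun ε t => Y (ε, t) * √(1 + c ^ 2 * fderiv ℝ Y (ε, t) (0, 1) ^ 2))
    (F' := fun ε t => fderiv ℝ Y (ε, t) (1, 0) * √(1 + c ^ 2 * fderiv ℝ Y (ε, t) (0, 1) ^ 2) +
      c ^ 2 * Y (ε, t) * fderiv ℝ Y (ε, t) (0, 1) / √(1 + c ^ 2 * fderiv ℝ Y (ε, t) (0, 1) ^ 2) *
        fderiv ℝ (fun q => fderiv ℝ Y q (0, 1)) (ε, t) (1, 0))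
    (hy.mul hW).continuous
    hF'
    (fun ε t => by
      have h1 := hasDerivAt_fst hYd ε t
      have h2 := hasDerivAt_fst hYtd ε t
      refine (h1.mul (((h2.pow 2).const_mul (c ^ 2)).const_add 1 |>.sqrt
        (by simp only [Pi.pow_apply]; positivity))).congr_deriv ?_
      have := hWpos (ε, t)
      simp only [Pi.pow_apply]
      field_simp
      ring) (-r) r
  refine ((hint.const_mul (2 * Real.sin (Real.pi / K))).congr_of_eventuallyEq ?_).congr_deriv ?_
  · have hpos : ∀ᶠ ε in 𝓝 (0 : ℝ), ∀ t ∈ Set.Icc (-r) r, 0 < y ε t := by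
      refine isCompact_Icc.eventually_forall_of_forall_eventually fun t _ => ?_
      exact hy.continuous.continuousAt.eventually_const_lt (by simpa [hYdef, hy0] using hx t)
    filter_upwards [hpos] with ε hε
    rw [ruledPieceArea_eq hK hr (fun t => (hasDerivAt_snd hYd ε t).differentiableAt) hε]
    simp only [hdt, hYdef, c]
  · congr 1
    have hη : ∀ t, deriv (fun ε => y ε t) 0 = fderiv ℝ Y (0, t) (1, 0) :=
      fun t => (hasDerivAt_fst hYd 0 t).deriv
    have hη' : ∀ t, HasDerivAt (fun t => fderiv ℝ Y (0, t) (1, 0))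
        (fderiv ℝ (fun q => fderiv ℝ Y q (0, 1)) (0, t) (1, 0)) t := by
      intro t
      rw [fderiv_fderiv_apply_comm hy]
      exact hasDerivAt_snd hYed 0 t
    have hηr : fderiv ℝ Y (0, r) (1, 0) = 0 ∧ fderiv ℝ Y (0, -r) (1, 0) = 0 := by
      rw [← hη, ← hη]
      simp [fun ε => (hyr ε).1, fun ε => (hyr ε).2]
    have hpair : Continuous fun t : ℝ => ((0 : ℝ), t) := by fun_prop
    have hI := (((contDiff_deriv_infty (contDiff_momentum c hxs)).continuous.mul
        (hYe.continuous.comp hpair)).add ((contDiff_momentum c hxs).continuous.mul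
        (hYte.continuous.comp hpair))).intervalIntegrable (μ := MeasureTheory.volume) (-r) r
    -- The boundary term vanishes because the variation fixes the profile at `±r`.
    have hparts := intervalIntegral.integral_eq_sub_of_hasDerivAt (a := -r) (b := r)
      (fun t _ => (((contDiff_momentum c hxs).differentiable (by simp) t).hasDerivAt.mul (hη' t))) hI
    simp only [Pi.mul_apply, hηr.1, hηr.2, mul_zero, sub_zero] at hparts
    have hsub := intervalIntegral.integral_sub
      ((hF'.comp hpair).intervalIntegrable (μ := MeasureTheory.volume) (-r) r) hI
    refine Eq.trans ?_ (hsub.symm.trans ?_)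
    · refine ((sub_zero _).symm.trans ?_)
      exact congrArg _ hparts.symm
    · refine intervalIntegral.integral_congr fun t _ => ?_
      simp only [hη, eulerLagrange, Function.comp_apply, Pi.add_apply, Pi.mul_apply, hdx]
      rw [show Y (0, t) = x t from hy0 t]
      ring

lemma isAreaCriticalRuled_iff {K : ℕ} (hK : 3 ≤ K) {x : ℝ → ℝ} (hxs : ContDiff ℝ ∞ x)
    (hx : ∀ t, 0 < x t) :
    IsAreaCriticalRuled K x ↔ ∀ t, eulerLagrange (Real.cos (Real.pi / K)) x t = 0 := by
  have hs := pos_sin_pi_div hK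
  constructor
  · intro h t₀
    by_contra hne
    set E := eulerLagrange (Real.cos (Real.pi / K)) x with hE
    have hEs : ContDiff ℝ ∞ E := contDiff_eulerLagrange _ hxs
    obtain ⟨r, hr⟩ : ∃ r, r = |t₀| + 1 := ⟨_, rfl⟩
    have hr0 : 0 < r := by rw [hr]; positivity
    have ht₀ : t₀ ^ 2 < r ^ 2 := by
      rw [sq_lt_sq, abs_of_pos hr0, hr]; linarith
    have hy : ContDiff ℝ ∞ (fun q : ℝ × ℝ => x q.2 + q.1 * ((r ^ 2 - q.2 ^ 2) * E q.2)) :=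
      (hxs.comp contDiff_snd).add (contDiff_fst.mul
        ((contDiff_const.sub (contDiff_snd.pow 2)).mul (hEs.comp contDiff_snd)))
    -- Varying along `(r² - t²) E` keeps the boundary fixed and makes the derivative a positive
    -- multiple of `∫ (r² - t²) E²`, so no bump functions are needed.
    have h1 := h r (fun ε t => x t + ε * ((r ^ 2 - t ^ 2) * E t)) hr0 hy (by simp) (by simp)
    have h2 := hasDerivAt_ruledPieceArea (y := fun ε t => x t + ε * ((r ^ 2 - t ^ 2) * E t))
      hK hr0 hx hy (by simp) (by simp)
    have h3 := h2.unique h1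
    have hd : ∀ t, deriv (fun ε : ℝ => x t + ε * ((r ^ 2 - t ^ 2) * E t)) 0 =
        (r ^ 2 - t ^ 2) * E t := fun t => by simp
    simp only [hd, ← hE] at h3
    have h4 := (mul_eq_zero.1 h3).resolve_left (by positivity)
    refine (intervalIntegral.integral_pos (by linarith : -r < r) ?_ ?_ ?_).ne' h4
    · exact Continuous.continuousOn (by have := hEs.continuous; fun_prop)
    · intro t ht
      have : t ^ 2 ≤ r ^ 2 := sq_le_sq' ht.1.le ht.2
      rw [mul_assoc]
      exact mul_nonneg (by linarith) (mul_self_nonneg _)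
    · refine ⟨t₀, abs_le.1 (by rw [hr]; linarith), ?_⟩
      rw [mul_assoc]
      exact mul_pos (by linarith) (mul_self_pos.2 hne)
  · intro h r y hr hy hy0 hyr
    have h1 := hasDerivAt_ruledPieceArea hK hr hx hy hy0 hyr
    simpa [h] using h1

/-- The equation reduces to `c² x x'' = 1 + c² x'²`, which has `(1 + c² x'²) / x²` as a first
integral. Its value at the neck is `1`, and substituting back leaves the linear equation `c² x'' =
x`. -/
lemma eq_cosh_of_eulerLagrange {c : ℝ} (hc : 0 < c) {x : ℝ → ℝ} (hxs : ContDiff ℝ ∞ x)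
    (hx : ∀ t, 0 < x t) (h0 : x 0 = 1) (h0' : deriv x 0 = 0)
    (hEL : ∀ t, eulerLagrange c x t = 0) : x = fun t => Real.cosh (c⁻¹ * t) := by
  have hd1 : ∀ t, HasDerivAt x (deriv x t) t :=
    fun t => (hxs.differentiable (by simp) t).hasDerivAt
  have hd2 : ∀ t, HasDerivAt (deriv x) (deriv (deriv x) t) t :=
    fun t => ((contDiff_deriv_infty hxs).differentiable (by simp) t).hasDerivAt
  have hode : ∀ t, c ^ 2 * x t * deriv (deriv x) t = 1 + c ^ 2 * deriv x t ^ 2 := by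
    intro t
    have h1 := hEL t
    have hpos : 0 < 1 + c ^ 2 * deriv x t ^ 2 := by positivity
    have h2 := (((hd1 t).const_mul (c ^ 2)).mul (hd2 t)).div
      ((((hd2 t).pow 2).const_mul (c ^ 2)).const_add 1 |>.sqrt
        (by simp only [Pi.pow_apply]; exact hpos.ne'))
      (by simp only [Pi.pow_apply]; positivity)
    have h3 := h2.deriv
    simp only [Pi.pow_apply, Pi.mul_apply] at h3
    rw [eulerLagrange] at h1
    erw [h3] at h1
    have hw : 0 < √(1 + c ^ 2 * deriv x t ^ 2) := Real.sqrt_pos.2 hpos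
    have hw2 := Real.sq_sqrt hpos.le
    generalize √(1 + c ^ 2 * deriv x t ^ 2) = w at *
    norm_num at h1
    field_simp at h1
    rw [show w ^ 4 = (w ^ 2) ^ 2 by ring, hw2, mul_zero] at h1
    linear_combination -h1
  -- The first integral, evaluated at the neck.
  have hq : ∀ t, (1 + c ^ 2 * deriv x t ^ 2) / x t ^ 2 = 1 := by
    intro t
    rw [eq_const_of_hasDerivAt_zero (F := fun t => (1 + c ^ 2 * deriv x t ^ 2) / x t ^ 2)
      (fun t => ?_) t 0]
    · rw [h0, h0']; norm_num
    · have h1 := hx t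
      refine (((((hd2 t).pow 2).const_mul (c ^ 2)).const_add 1).div ((hd1 t).pow 2)
        (by simp only [Pi.pow_apply]; positivity)).congr_deriv ?_
      simp only [Pi.pow_apply]
      have h2 := hode t
      field_simp
      norm_num
      linear_combination deriv x t * x t * h2
  refine eq_cosh_of_hasDerivAt (b := c⁻¹) (f := x) (g := fun t => c * deriv x t) (fun t => ?_)
    (fun t => ?_) h0 (by simp [h0'])
  · refine (hd1 t).congr_deriv ?_
    field_simp
  · refine ((hd2 t).const_mul c).congr_deriv ?_
    have h1 := hq t
    have h2 := hode t
    have h3 := hx t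
    rw [div_eq_one_iff_eq (by positivity)] at h1
    rw [h1] at h2
    have h4 : x t * (c ^ 2 * deriv (deriv x) t) = x t * x t := by linarith
    have h5 := mul_left_cancel₀ h3.ne' h4
    field_simp
    exact h5

lemma eulerLagrange_cosh {c : ℝ} (hc : 0 < c) (t : ℝ) :
    eulerLagrange c (fun t => Real.cosh (c⁻¹ * t)) t = 0 := by
  have hd : ∀ t, HasDerivAt (fun t => c⁻¹ * t) c⁻¹ t := fun t => by
    simpa using (hasDerivAt_id t).const_mul c⁻¹
  have h1 : deriv (fun t => Real.cosh (c⁻¹ * t)) = fun t => Real.sinh (c⁻¹ * t) * c⁻¹ :=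
    funext fun t => (hd t).cosh.deriv
  have h2 : ∀ t, √(1 + c ^ 2 * (Real.sinh (c⁻¹ * t) * c⁻¹) ^ 2) = Real.cosh (c⁻¹ * t) := by
    intro t
    rw [← Real.sqrt_sq (Real.cosh_pos (c⁻¹ * t)).le, Real.cosh_sq]
    congr 1
    field_simp
    ring
  have h3 : (fun t => c ^ 2 * Real.cosh (c⁻¹ * t) * (Real.sinh (c⁻¹ * t) * c⁻¹) /
      Real.cosh (c⁻¹ * t)) = fun t => c * Real.sinh (c⁻¹ * t) := by
    funext t
    have := Real.cosh_pos (c⁻¹ * t)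
    field_simp
  rw [eulerLagrange, h1]
  simp only [h2]
  rw [h3, ((hd t).sinh.const_mul c).deriv]
  field_simp
  ring

lemma mem_MpsrdProfiles_iff {K : ℕ} (hK : 3 ≤ K) {p : ℝ → E3} :
    p ∈ MpsrdProfiles K ↔
      p = graphProfile (fun t => Real.cosh ((Real.cos (Real.pi / K))⁻¹ * t)) := by
  have hc := pos_cos_pi_div hK
  constructor
  · rintro ⟨x, hxs, hx, h0, h0', hcrit, rfl⟩
    rw [isAreaCriticalRuled_iff hK hxs hx] at hcrit
    rw [eq_cosh_of_eulerLagrange hc hxs hx h0 h0' hcrit]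
  · rintro rfl
    have hs : ContDiff ℝ ∞ (fun t => Real.cosh ((Real.cos (Real.pi / K))⁻¹ * t)) :=
      Real.contDiff_cosh.comp (contDiff_const.mul contDiff_id)
    have hpos : ∀ t, 0 < Real.cosh ((Real.cos (Real.pi / K))⁻¹ * t) := fun t => Real.cosh_pos _
    refine ⟨_, hs, hpos, by simp, ?_,
      (isAreaCriticalRuled_iff hK hs hpos).2 (eulerLagrange_cosh hc), rfl⟩
    have : HasDerivAt (fun t => (Real.cos (Real.pi / K))⁻¹ * t) (Real.cos (Real.pi / K))⁻¹ 0 := by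
      simpa using (hasDerivAt_id (0 : ℝ)).const_mul (Real.cos (Real.pi / K))⁻¹
    rw [this.cosh.deriv]
    simp

/-! ### Comparison of the profile curves -/

lemma existsUnique_of_forall_mem_iff {α : Type*} {S : Set α} {q : α} (h : ∀ p, p ∈ S ↔ p = q) :
    ∃! p, p ∈ S :=
  ⟨q, (h q).2 rfl, fun p hp => (h p).1 hp⟩

/-- Each spacing is an integer multiple of the other, and both are positive, so they coincide.
Vertices at equal height must then have equal radius. -/
lemma eq_of_range_discreteProfile_eq {ℓ ℓ' : ℝ} (hℓ : 0 < ℓ) (hℓ' : 0 < ℓ') {x x' : ℤ → ℝ}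
    (h : Set.range (discreteProfile ℓ x) = Set.range (discreteProfile ℓ' x')) :
    ℓ = ℓ' ∧ x 1 = x' 1 := by
  obtain ⟨m, hm⟩ : discreteProfile ℓ x 1 ∈ Set.range (discreteProfile ℓ' x') := h ▸ ⟨1, rfl⟩
  obtain ⟨m', hm'⟩ : discreteProfile ℓ' x' 1 ∈ Set.range (discreteProfile ℓ x) := h ▸ ⟨1, rfl⟩
  have a0 := congrArg (fun v : E3 => v 0) hm
  have a2 := congrArg (fun v : E3 => v 2) hm
  have b2 := congrArg (fun v : E3 => v 2) hm'
  simp [discreteProfile] at a0 a2 b2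
  have hmpos : (0 : ℝ) < m := by
    by_contra hneg
    nlinarith
  have hmm : (m : ℝ) * m' = 1 := by
    have : ℓ * ((m : ℝ) * m') = ℓ * 1 := by rw [← a2] at b2 ⊢; linear_combination (m : ℝ) * b2
    exact mul_left_cancel₀ hℓ.ne' this
  have hm1 : m = 1 := by
    have h1 : 0 < m := by exact_mod_cast hmpos
    have h2 : m * m' = 1 := by exact_mod_cast hmm
    exact (Int.eq_one_or_neg_one_of_mul_eq_one h2).resolve_right (by omega)
  subst hm1
  exact ⟨by simpa using a2.symm, a0.symm⟩

lemma smoothProfile_eq : smoothProfile = graphProfile Real.cosh := by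
  funext t
  apply ext_E3 <;> simp [smoothProfile, smoothCatenoid, rotPt, graphProfile]

lemma one_lt_one_add_sq_div {c ℓ : ℝ} (hc : 0 < c) (hℓ : 0 < ℓ) :
    1 < 1 + ℓ ^ 2 / (2 * c ^ 2) := by
  have : 0 < ℓ ^ 2 / (2 * c ^ 2) := by positivity
  linarith

lemma discreteCosh_arcosh_one {c ℓ : ℝ} (hc : 0 < c) (hℓ : 0 < ℓ) :
    discreteCosh (Real.arcosh (1 + ℓ ^ 2 / (2 * c ^ 2))) 1 = 1 + ℓ ^ 2 / (2 * c ^ 2) := by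
  rw [discreteCosh, Int.cast_one, one_mul, Real.cosh_arcosh (one_lt_one_add_sq_div hc hℓ).le]

/-- This is `√(1 + ℓ²) < 1 + ℓ² / 2 ≤ 1 + ℓ² / (2 c²)`; it separates the integrable from the
area-critical discrete profiles. -/
lemma discreteCosh_arsinh_one_lt {c ℓ : ℝ} (hc : 0 < c) (hc1 : c ≤ 1) (hℓ : 0 < ℓ) :
    discreteCosh (Real.arsinh ℓ) 1 <
      discreteCosh (Real.arcosh (1 + ℓ ^ 2 / (2 * c ^ 2))) 1 := by
  rw [discreteCosh_arcosh_one hc hℓ, discreteCosh, Int.cast_one, one_mul, Real.cosh_arsinh]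
  have h1 : ℓ ^ 2 / 2 ≤ ℓ ^ 2 / (2 * c ^ 2) := by
    apply div_le_div_of_nonneg_left <;> nlinarith [sq_pos_of_pos hc]
  refine lt_of_lt_of_le ?_ (add_le_add_right h1 1)
  rw [Real.sqrt_lt' (by positivity)]
  have : 0 < ℓ ^ 4 := by positivity
  nlinarith

lemma range_MWpdrs_ne_range {c h ℓ : ℝ} (hc : 0 < c) (hc1 : c ≤ 1) (hh : 0 < h) (hℓ : 0 < ℓ) :
    Set.range (discreteProfile h (discreteCosh (Real.arsinh h))) ≠
      Set.range (discreteProfile ℓ (discreteCosh (Real.arcosh (1 + ℓ ^ 2 / (2 * c ^ 2))))) := by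
  intro e
  obtain ⟨rfl, e1⟩ := eq_of_range_discreteProfile_eq hh hℓ e
  exact (discreteCosh_arsinh_one_lt hc hc1 hh).ne e1

/-- A negative `c₁` only reverses the numbering of the vertices, which the point set does not see.
-/
lemma range_discreteProfile_sinh {c₁ : ℝ} (h₁ : c₁ ≠ 0) :
    Set.range (discreteProfile (Real.sinh c₁) (discreteCosh c₁)) =
      Set.range (discreteProfile |Real.sinh c₁| (discreteCosh (Real.arsinh |Real.sinh c₁|))) := by
  rcases lt_or_gt_of_ne h₁ with h | h
  · rw [abs_of_neg (Real.sinh_neg_iff.2 h), ← Real.sinh_neg, Real.arsinh_sinh,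
      ← (Equiv.neg ℤ).surjective.range_comp (discreteProfile (Real.sinh c₁) (discreteCosh c₁))]
    congr 1
    funext n
    apply ext_E3 <;> simp [discreteProfile, discreteCosh]
  · rw [abs_of_pos (Real.sinh_pos_iff.2 h), Real.arsinh_sinh]

lemma range_BP_eq_iff {c₂ : ℝ} (h₂ : Real.sin (c₂ / 2) ≠ 0) (S : Set E3) :
    (∃ c₁ : ℝ, c₁ ≠ 0 ∧ ∃ p ∈ BPProfiles c₁ c₂, Set.range p = S) ↔
      (∃ h : ℝ, 0 < h ∧ ∃ p ∈ MWpdrsProfiles h, Set.range p = S) := by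
  constructor
  · rintro ⟨c₁, h₁, p, hp, rfl⟩
    have hpos : 0 < |Real.sinh c₁| := abs_pos.2 (by simpa using h₁)
    refine ⟨_, hpos, _, (mem_MWpdrsProfiles_iff hpos).2 rfl, ?_⟩
    rw [(mem_BPProfiles_iff h₁ h₂).1 hp, range_discreteProfile_sinh h₁]
  · rintro ⟨h, hh, p, hp, rfl⟩
    have hpos : 0 < Real.arsinh h := by
      rw [← Real.sinh_pos_iff, Real.sinh_arsinh]; exact hh
    refine ⟨_, hpos.ne', _, (mem_BPProfiles_iff hpos.ne' h₂).2 rfl, ?_⟩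
    rw [(mem_MWpdrsProfiles_iff hh).1 hp, Real.sinh_arsinh]

lemma range_BP_ne_range {c c₁ c₂ ℓ : ℝ} (hc : 0 < c) (hc1 : c ≤ 1) (h₁ : c₁ ≠ 0)
    (h₂ : Real.sin (c₂ / 2) ≠ 0) (hℓ : 0 < ℓ) {p : ℤ → E3} (hp : p ∈ BPProfiles c₁ c₂) :
    Set.range p ≠
      Set.range (discreteProfile ℓ (discreteCosh (Real.arcosh (1 + ℓ ^ 2 / (2 * c ^ 2))))) := by
  rw [(mem_BPProfiles_iff h₁ h₂).1 hp, range_discreteProfile_sinh h₁]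
  exact range_MWpdrs_ne_range hc hc1 (abs_pos.2 (by simpa using h₁)) hℓ

/-- For a common spacing the radius `1 + ℓ² / (2 c²)` next to the neck is strictly larger for `c <
1` than for `c = 1`. -/
lemma range_PR_ne_range_Mpdrs {c ℓ ℓ' : ℝ} (hc : 0 < c) (hc1 : c < 1) (hℓ : 0 < ℓ) (hℓ' : 0 < ℓ') :
    Set.range (discreteProfile ℓ (discreteCosh (Real.arcosh (1 + ℓ ^ 2 / (2 * c ^ 2))))) ≠
      Set.range (discreteProfile ℓ' (discreteCosh (Real.arcosh (1 + ℓ' ^ 2 / (2 * 1 ^ 2))))) := by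
  intro e
  obtain ⟨rfl, e1⟩ := eq_of_range_discreteProfile_eq hℓ hℓ' e
  rw [discreteCosh_arcosh_one hc hℓ, discreteCosh_arcosh_one one_pos hℓ, add_right_inj,
    div_eq_div_iff (by positivity) (by positivity)] at e1
  have h2 : c ^ 2 < 1 := by nlinarith
  have h3 : 0 < ℓ ^ 2 * (1 - c ^ 2) := mul_pos (by positivity) (by linarith)
  linarith

lemma tendsto_cos_pi_div : Tendsto (fun K : ℕ => Real.cos (Real.pi / K)) atTop (𝓝 1) := by
  have h : Tendsto (fun K : ℕ => Real.pi / (K : ℝ)) atTop (𝓝 0) :=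
    tendsto_const_div_atTop_nhds_zero_nat Real.pi
  simpa [Function.comp_def] using (Real.continuous_cos.tendsto 0).comp h

lemma tendsto_PR {ℓ : ℝ} (hℓ : 0 < ℓ) (n : ℤ) :
    Tendsto (fun K : ℕ => discreteProfile ℓ
      (discreteCosh (Real.arcosh (1 + ℓ ^ 2 / (2 * Real.cos (Real.pi / K) ^ 2)))) n) atTop
      (𝓝 (discreteProfile ℓ (discreteCosh (Real.arcosh (1 + ℓ ^ 2 / (2 * 1 ^ 2)))) n)) := by
  have h1 : Tendsto (fun K : ℕ => 1 + ℓ ^ 2 / (2 * Real.cos (Real.pi / K) ^ 2)) atTop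
      (𝓝 (1 + ℓ ^ 2 / (2 * 1 ^ 2))) :=
    tendsto_const_nhds.add (tendsto_const_nhds.div
      (tendsto_const_nhds.mul (tendsto_cos_pi_div.pow 2)) (by norm_num))
  have h2 := (Real.hasDerivAt_arcosh (one_lt_one_add_sq_div one_pos hℓ)).continuousAt.tendsto.comp h1
  have h3 := ((Real.continuous_cosh.tendsto _).comp (h2.const_mul (n : ℝ)))
  exact ((hasDerivAt_E3 (hasDerivAt_id _) (hasDerivAt_const _ (0 : ℝ))
    (hasDerivAt_const _ ((n : ℝ) * ℓ))).continuousAt.tendsto).comp h3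

lemma tendstoLocallyUniformly_Mpsrd {p : ℕ → ℝ → E3} (hp : ∀ K, 3 ≤ K → p K ∈ MpsrdProfiles K) :
    TendstoLocallyUniformly p smoothProfile atTop := by
  rw [tendstoLocallyUniformly_iff_forall_tendsto]
  intro t₀
  -- Joint continuity in the scale factor and the height yields locally uniform convergence at once.
  have hG : Continuous fun q : ℝ × ℝ => (!₂[Real.cosh (q.1 * q.2), 0, q.2] : E3) := by
    refine (EuclideanSpace.equiv (Fin 3) ℝ).symm.continuous.comp (continuous_pi fun i => ?_)
    fin_cases i <;> simp <;> fun_prop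
  have hb : Tendsto (fun K : ℕ => (Real.cos (Real.pi / K))⁻¹) atTop (𝓝 1) := by
    simpa using tendsto_cos_pi_div.inv₀ one_ne_zero
  have h1 : Tendsto (fun y : ℕ × ℝ => ((1, y.2), ((Real.cos (Real.pi / y.1))⁻¹, y.2)))
      (atTop ×ˢ 𝓝 t₀) (𝓝 (((1 : ℝ), t₀), ((1 : ℝ), t₀))) :=
    (tendsto_const_nhds.prodMk_nhds tendsto_snd).prodMk_nhds
      ((hb.comp tendsto_fst).prodMk_nhds tendsto_snd)
  have h2 := ((hG.prodMap hG).tendsto (((1 : ℝ), t₀), ((1 : ℝ), t₀))).comp h1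
  refine (h2.mono_right (nhds_le_uniformity _)).congr' ?_
  filter_upwards [(eventually_ge_atTop 3).prod_inl (𝓝 t₀)] with y hy
  rw [(mem_MpsrdProfiles_iff hy).1 (hp y.1 hy), smoothProfile_eq]
  simp [graphProfile]

lemma range_Mpsrd_ne_range_smooth {c : ℝ} (hc : 0 < c) (hc1 : c < 1) :
    Set.range (graphProfile fun t => Real.cosh (c⁻¹ * t)) ≠ Set.range smoothProfile := by
  intro e
  obtain ⟨t, ht⟩ : graphProfile (fun t => Real.cosh (c⁻¹ * t)) 1 ∈ Set.range smoothProfile :=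
    e ▸ ⟨1, rfl⟩
  rw [smoothProfile_eq] at ht
  have a0 := congrArg (fun v : E3 => v 0) ht
  have a2 := congrArg (fun v : E3 => v 2) ht
  simp [graphProfile] at a0 a2
  subst a2
  have h1 : 1 < c⁻¹ := (one_lt_inv₀ hc).2 hc1
  refine (Real.cosh_lt_cosh.2 ?_).ne a0
  rwa [abs_one, abs_of_pos (by positivity)]

/-- Vertex `n` corresponds to the parameter `s = n a`, so the vertical scale is `ℓ / a`. Only the
quotient is assumed positive, which covers negative `c₁`, where `ℓ = sinh c₁` and `a = c₁` are both
negative. -/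
lemma liesOnScaledCosh_discreteProfile {a ℓ : ℝ} (h : 0 < ℓ / a) :
    LiesOnScaledCosh (discreteProfile ℓ (discreteCosh a)) := by
  refine ⟨1, ℓ / a, one_pos, h, ?_⟩
  have ha : a ≠ 0 := by rintro rfl; simp at h
  rintro _ ⟨n, rfl⟩
  refine ⟨n * a, ?_⟩
  rw [discreteProfile, discreteCosh, one_mul, show ℓ / a * (n * a) = n * ℓ by field_simp]

lemma liesOnScaledCosh_graphProfile {c : ℝ} (hc : 0 < c) :
    LiesOnScaledCosh (graphProfile fun t => Real.cosh (c⁻¹ * t)) := by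
  refine ⟨1, c, one_pos, hc, ?_⟩
  rintro _ ⟨t, rfl⟩
  refine ⟨c⁻¹ * t, ?_⟩
  rw [graphProfile, one_mul, mul_inv_cancel_left₀ hc.ne']

lemma liesOnScaledCosh_cosh : LiesOnScaledCosh (graphProfile Real.cosh) := by
  simpa using liesOnScaledCosh_graphProfile one_pos

lemma sinh_div_self_pos {a : ℝ} (ha : a ≠ 0) : 0 < Real.sinh a / a := by
  rcases lt_or_gt_of_ne ha with h | h
  · exact div_pos_of_neg_of_neg (Real.sinh_neg_iff.2 h) h
  · exact div_pos (Real.sinh_pos_iff.2 h) h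

end Catenoids

/-! ### The comparison theorem -/

open Catenoids in
theorem mainTheorem2 :
    -- each normalized catenoid exists and has exactly one profile curve
    ((∀ (K : ℕ) (δ : ℤ → ℤ → Bool) (ℓ : ℝ), 3 ≤ K → 0 < ℓ → ∃! p, p ∈ PRProfiles K δ ℓ) ∧
      (∀ ℓ : ℝ, 0 < ℓ → ∃! p, p ∈ MpdrsProfiles ℓ) ∧
      (∀ c₁ c₂ : ℝ, c₁ ≠ 0 → Real.sin (c₂ / 2) ≠ 0 → ∃! p, p ∈ BPProfiles c₁ c₂) ∧
      (∀ h : ℝ, 0 < h → ∃! p, p ∈ MWpdrsProfiles h) ∧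
      (∀ α : ℝ, 0 < α → Real.sin (α / 2) ≠ 0 → ∃! p, p ∈ MWpsrdProfiles α) ∧
      (∀ K : ℕ, 3 ≤ K → ∃! p, p ∈ MpsrdProfiles K)) ∧
    -- (1) PR and M_{pd,rs}: never the same, but PR converges to M_{pd,rs}
    ((∀ (K : ℕ) (δ : ℤ → ℤ → Bool) (ℓ ℓ' : ℝ), 3 ≤ K → 0 < ℓ → 0 < ℓ' →
        ∀ p ∈ PRProfiles K δ ℓ, ∀ q ∈ MpdrsProfiles ℓ', Set.range p ≠ Set.range q) ∧
      (∀ (ℓ : ℝ) (δ : ℕ → ℤ → ℤ → Bool) (p : ℕ → ℤ → E3), 0 < ℓ →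
        (∀ K, 3 ≤ K → p K ∈ PRProfiles K (δ K) ℓ) →
        ∀ q ∈ MpdrsProfiles ℓ, ∀ n, Tendsto (fun K => p K n) atTop (𝓝 (q n)))) ∧
    -- (2) BP and MW_{pd,rs}: the same profile curves
    (∀ c₂ : ℝ, Real.sin (c₂ / 2) ≠ 0 → ∀ S : Set E3,
      (∃ c₁ : ℝ, c₁ ≠ 0 ∧ ∃ p ∈ BPProfiles c₁ c₂, Set.range p = S) ↔
        (∃ h : ℝ, 0 < h ∧ ∃ p ∈ MWpdrsProfiles h, Set.range p = S)) ∧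
    -- (3) BP, MW_{pd,rs} versus PR, M_{pd,rs}: never the same
    ((∀ (c₁ c₂ : ℝ) (K : ℕ) (δ : ℤ → ℤ → Bool) (ℓ : ℝ),
        c₁ ≠ 0 → Real.sin (c₂ / 2) ≠ 0 → 3 ≤ K → 0 < ℓ →
        ∀ p ∈ BPProfiles c₁ c₂, ∀ q ∈ PRProfiles K δ ℓ, Set.range p ≠ Set.range q) ∧
      (∀ (h : ℝ) (K : ℕ) (δ : ℤ → ℤ → Bool) (ℓ : ℝ), 0 < h → 3 ≤ K → 0 < ℓ →
        ∀ p ∈ MWpdrsProfiles h, ∀ q ∈ PRProfiles K δ ℓ, Set.range p ≠ Set.range q) ∧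
      (∀ c₁ c₂ ℓ : ℝ, c₁ ≠ 0 → Real.sin (c₂ / 2) ≠ 0 → 0 < ℓ →
        ∀ p ∈ BPProfiles c₁ c₂, ∀ q ∈ MpdrsProfiles ℓ, Set.range p ≠ Set.range q) ∧
      (∀ h ℓ : ℝ, 0 < h → 0 < ℓ →
        ∀ p ∈ MWpdrsProfiles h, ∀ q ∈ MpdrsProfiles ℓ, Set.range p ≠ Set.range q)) ∧
    -- (4) the smooth catenoid and MW_{ps,rd}: the same profile curve
    (∀ α : ℝ, 0 < α → Real.sin (α / 2) ≠ 0 → ∀ p ∈ MWpsrdProfiles α, p = smoothProfile) ∧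
    -- (5) M_{ps,rd} and the smooth catenoid: never the same, but M_{ps,rd} converges to it
    ((∀ K : ℕ, 3 ≤ K → ∀ p ∈ MpsrdProfiles K, Set.range p ≠ Set.range smoothProfile) ∧
      (∀ p : ℕ → ℝ → E3, (∀ K, 3 ≤ K → p K ∈ MpsrdProfiles K) →
        TendstoLocallyUniformly p smoothProfile atTop)) ∧
    -- (6) all vertices of all profile curves lie on affinely scaled graphs of cosh
    (LiesOnScaledCosh smoothProfile ∧
      (∀ c₁ c₂ : ℝ, c₁ ≠ 0 → Real.sin (c₂ / 2) ≠ 0 →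
        ∀ p ∈ BPProfiles c₁ c₂, LiesOnScaledCosh p) ∧
      (∀ (K : ℕ) (δ : ℤ → ℤ → Bool) (ℓ : ℝ), 3 ≤ K → 0 < ℓ →
        ∀ p ∈ PRProfiles K δ ℓ, LiesOnScaledCosh p) ∧
      (∀ ℓ : ℝ, 0 < ℓ → ∀ p ∈ MpdrsProfiles ℓ, LiesOnScaledCosh p) ∧
      (∀ h : ℝ, 0 < h → ∀ p ∈ MWpdrsProfiles h, LiesOnScaledCosh p) ∧
      (∀ α : ℝ, 0 < α → Real.sin (α / 2) ≠ 0 → ∀ p ∈ MWpsrdProfiles α, LiesOnScaledCosh p) ∧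
      (∀ K : ℕ, 3 ≤ K → ∀ p ∈ MpsrdProfiles K, LiesOnScaledCosh p)) := by
  refine ⟨⟨fun K δ ℓ hK hℓ => existsUnique_of_forall_mem_iff fun p => mem_PRProfiles_iff hK δ hℓ,
      fun ℓ hℓ => existsUnique_of_forall_mem_iff fun p => mem_MpdrsProfiles_iff hℓ,
      fun c₁ c₂ h₁ h₂ => existsUnique_of_forall_mem_iff fun p => mem_BPProfiles_iff h₁ h₂,
      fun h hh => existsUnique_of_forall_mem_iff fun p => mem_MWpdrsProfiles_iff hh,
      fun α _ hα => existsUnique_of_forall_mem_iff fun p => mem_MWpsrdProfiles_iff hα,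
      fun K hK => existsUnique_of_forall_mem_iff fun p => mem_MpsrdProfiles_iff hK⟩,
    ⟨fun K δ ℓ ℓ' hK hℓ hℓ' p hp q hq => ?_, fun ℓ δ p hℓ hp q hq n => ?_⟩,
    fun c₂ h₂ S => range_BP_eq_iff h₂ S,
    ⟨fun c₁ c₂ K δ ℓ h₁ h₂ hK hℓ p hp q hq => ?_, fun h K δ ℓ hh hK hℓ p hp q hq => ?_,
      fun c₁ c₂ ℓ h₁ h₂ hℓ p hp q hq => ?_, fun h ℓ hh hℓ p hp q hq => ?_⟩,
    fun α _ hα p hp => ?_,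
    ⟨fun K hK p hp => ?_, fun p hp => tendstoLocallyUniformly_Mpsrd hp⟩,
    smoothProfile_eq ▸ liesOnScaledCosh_cosh, fun c₁ c₂ h₁ h₂ p hp => ?_,
    fun K δ ℓ hK hℓ p hp => ?_, fun ℓ hℓ p hp => ?_, fun h hh p hp => ?_, fun α _ hα p hp => ?_,
    fun K hK p hp => ?_⟩
  · rw [(mem_PRProfiles_iff hK δ hℓ).1 hp, (mem_MpdrsProfiles_iff hℓ').1 hq]
    exact range_PR_ne_range_Mpdrs (pos_cos_pi_div hK) (cos_pi_div_lt_one hK) hℓ hℓ'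
  · rw [(mem_MpdrsProfiles_iff hℓ).1 hq]
    refine (tendsto_PR hℓ n).congr' ?_
    -- Nothing is assumed about `p K` for `K < 3`, which does not affect the limit.
    filter_upwards [eventually_ge_atTop 3] with K hK
    rw [(mem_PRProfiles_iff hK (δ K) hℓ).1 (hp K hK)]
  · rw [(mem_PRProfiles_iff hK δ hℓ).1 hq]
    exact range_BP_ne_range (pos_cos_pi_div hK) (Real.cos_le_one _) h₁ h₂ hℓ hp
  · rw [(mem_PRProfiles_iff hK δ hℓ).1 hq, (mem_MWpdrsProfiles_iff hh).1 hp]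
    exact range_MWpdrs_ne_range (pos_cos_pi_div hK) (Real.cos_le_one _) hh hℓ
  · rw [(mem_MpdrsProfiles_iff hℓ).1 hq]
    exact range_BP_ne_range one_pos le_rfl h₁ h₂ hℓ hp
  · rw [(mem_MpdrsProfiles_iff hℓ).1 hq, (mem_MWpdrsProfiles_iff hh).1 hp]
    exact range_MWpdrs_ne_range one_pos le_rfl hh hℓ
  · rw [(mem_MWpsrdProfiles_iff hα).1 hp, smoothProfile_eq]
  · rw [(mem_MpsrdProfiles_iff hK).1 hp]
    exact range_Mpsrd_ne_range_smooth (pos_cos_pi_div hK) (cos_pi_div_lt_one hK)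
  · rw [(mem_BPProfiles_iff h₁ h₂).1 hp]
    exact liesOnScaledCosh_discreteProfile (sinh_div_self_pos h₁)
  · rw [(mem_PRProfiles_iff hK δ hℓ).1 hp]
    exact liesOnScaledCosh_discreteProfile
      (div_pos hℓ (Real.arcosh_pos (one_lt_one_add_sq_div (pos_cos_pi_div hK) hℓ)))
  · rw [(mem_MpdrsProfiles_iff hℓ).1 hp]
    exact liesOnScaledCosh_discreteProfile
      (div_pos hℓ (Real.arcosh_pos (one_lt_one_add_sq_div one_pos hℓ)))
  · rw [(mem_MWpdrsProfiles_iff hh).1 hp]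
    refine liesOnScaledCosh_discreteProfile (div_pos hh ?_)
    rw [← Real.sinh_pos_iff, Real.sinh_arsinh]
    exact hh
  · rw [(mem_MWpsrdProfiles_iff hα).1 hp]
    exact liesOnScaledCosh_cosh
  · rw [(mem_MpsrdProfiles_iff hK).1 hp]
    exact liesOnScaledCosh_graphProfile (pos_cos_pi_div hK)
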